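/- Let $n\ge 2$ and let $(X,\omega)$ be a compact hermitian manifold of complex dimension $n$; here $\omega$ is the fundamental form of the metric, a smooth positive $(1,1)$-form. Write $d^c=\frac{i}{2}(\bar\partial-\partial)$, so that $dd^c=i\partial\bar\partial$, and for smooth $f:X\to\mathbb R$ put $$\Delta_\omega f=\frac{n\,dd^cf\wedge\omega^{n-1}}{\omega^n},\qquad |df|^2_\omega=\frac{n\,df\wedge d^cf\wedge\omega^{n-1}}{\omega^n},\qquad \mathrm{Vol}_\omega(X)=\int_X\omega^n .$$ Let $\Delta_\omega^*$ be the adjoint of $\Delta_\omega$ with respect to the $L^2$ inner product $\langle u,v\rangle=\int_X uv\,\omega^n$; thus a smooth function $\rho$ lies in $\ker\Delta_\omega^*$ if and only if $\int_X\rho\,\Delta_\omega f\,\omega^n=0$ for all smooth $f$. Let $B$, $C_S$, $C_P$ be real constants such that $$-B\,\omega^n\le dd^c\omega^{n-1}\le B\,\omega^n\quad\text{on }X,$$ $$\Big(\int_X|f|^{\frac{2n}{n-1}}\omega^n\Big)^{\frac{n-1}{n}}\le C_S\Big(\int_X|df|^2_\omega\,\omega^n+\int_X|f|^2\omega^n\Big)\quad\text{for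 all smooth } f:X\to\mathbb R,$$ $$\int_X|f|^2\omega^n\le C_P\int_X|df|^2_\omega\,\omega^n\quad\text{for all smooth } f:X\to\mathbb R\text{ with }\int_Xf\,\omega^n=0.$$ Then there is a constant $C_G$, depending only on $n$, $B$, $C_S$, $C_P$ and $\mathrm{Vol}_\omega(X)$, such that every smooth function $\rho\in\ker\Delta_\omega^*$ with $\inf_X\rho=1$ satisfies $$\sup_X\rho\le C_G .$$ -/

import Mathlib

open scoped Manifold ContDiff TensorProduct
open MeasureTheory

noncomputable section

namespace GauduchonFactor

/-! ### Alternating forms on a real vector space -/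

section Algebra

variable {V : Type*} [AddCommGroup V] [Module ℝ V] [TopologicalSpace V]

/-- The wedge product of alternating forms (shuffle convention, so that
`(α ∧ β) (u, v) = α u * β v - α v * β u` for `1`-forms), obtained from Mathlib's
`AlternatingMap.domCoprod`. -/
def wedge {k l : ℕ} (α : V [⋀^Fin k]→L[ℝ] ℝ) (β : V [⋀^Fin l]→L[ℝ] ℝ) :
    V [⋀^Fin (k + l)]→L[ℝ] ℝ :=
  let a : V [⋀^Fin (k + l)]→ₗ[ℝ] ℝ :=
    ((LinearMap.mul' ℝ ℝ).compAlternatingMap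
      (α.toAlternatingMap.domCoprod β.toAlternatingMap)).domDomCongr finSumFinEquiv
  { a with
    cont := by
      change Continuous fun v : Fin (k + l) → V => LinearMap.mul' ℝ ℝ
        ((α.toAlternatingMap.domCoprod β.toAlternatingMap) fun i => v (finSumFinEquiv i))
      simp only [AlternatingMap.domCoprod_apply, sum_apply, map_sum]
      refine continuous_finsetSum _ fun σ _ => ?_
      induction σ using Quotient.inductionOn' with
      | h σ =>
        rw [AlternatingMap.domCoprod.summand_mk'']
        change Continuous fun v : Fin (k + l) → V => LinearMap.mul' ℝ ℝ
          (((Equiv.Perm.sign σ : ℤˣ) : ℤ) •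
            ((α fun i => v (finSumFinEquiv (σ (Sum.inl i)))) ⊗ₜ[ℝ]
              (β fun i => v (finSumFinEquiv (σ (Sum.inr i))))))
        simp only [map_zsmul, LinearMap.mul'_apply]
        refine (Continuous.mul ?_ ?_).const_smul (Equiv.Perm.sign σ : ℤ)
        · exact α.coe_continuous.comp (continuous_pi fun i => continuous_apply _)
        · exact β.coe_continuous.comp (continuous_pi fun i => continuous_apply _) }

/-- The wedge powers `α ^ m` of a `2`-form. -/
def wedgePow (α : V [⋀^Fin 2]→L[ℝ] ℝ) : (m : ℕ) → V [⋀^Fin (2 * m)]→L[ℝ] ℝ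
  | 0 => ContinuousAlternatingMap.constOfIsEmpty ℝ V (Fin 0) 1
  | m + 1 => wedge (wedgePow α m) α

end Algebra

/-! ### The model space `ℂⁿ` -/

/-- The model space `ℂⁿ`. -/
abbrev Cn (n : ℕ) : Type := Fin n → ℂ

/-- The complex structure of `ℂⁿ`: multiplication by `i`, as a real linear map. -/
def cplxJ (n : ℕ) : Cn n →L[ℝ] Cn n := Complex.I • ContinuousLinearMap.id ℝ (Cn n)

/-- The first `k` vectors of the positively oriented real frame
`e₁, i e₁, e₂, i e₂, …, eₙ, i eₙ` of `ℂⁿ`. It is only used for `k = 2 n`. -/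
def stdFrame (n k : ℕ) : Fin k → Cn n := fun i j =>
  if (j : ℕ) = (i : ℕ) / 2 then (if (i : ℕ) % 2 = 0 then 1 else Complex.I) else 0

/-- The coefficient of a top degree form (`k = 2 n`) with respect to
`dx₁ ∧ dy₁ ∧ … ∧ dxₙ ∧ dyₙ`. -/
def topCoeff {n k : ℕ} (α : Cn n [⋀^Fin k]→L[ℝ] ℝ) : ℝ := α (stdFrame n k)

/-! ### Differential forms on a manifold modelled on `ℂⁿ` -/

section Forms

variable {n : ℕ} {X : Type*} [TopologicalSpace X] [ChartedSpace (Cn n) X]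

variable (n X) in
/-- Real differential `k`-forms (not necessarily smooth) on `X`: at each `x`, an alternating form
on the tangent space at `x`. As in Mathlib's `TangentSpace`, the tangent space at `x` is the model
space `ℂⁿ`, a vector being identified with its coordinates in the preferred chart `chartAt x`. -/
abbrev DForm (k : ℕ) : Type _ := X → Cn n [⋀^Fin k]→L[ℝ] ℝ

/-- The expression `(φ⁻¹)^* α` of a form in a chart `φ`; meaningful on `φ.target`. At `y = φ x` the
derivative of `φ⁻¹`, as a map to the tangent space at `x`, is the derivative of the change of
coordinates from `φ` to the preferred chart at `x`. -/
def DForm.inChart {k : ℕ} (α : DForm n X k) (φ : OpenPartialHomeomorph X (Cn n)) (y : Cn n) :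
    Cn n [⋀^Fin k]→L[ℝ] ℝ :=
  (α (φ.symm y)).compContinuousLinearMap
    (fderiv ℝ (fun z => chartAt (Cn n) (φ.symm y) (φ.symm z)) y)

/-- Smoothness of a form: all its chart expressions are smooth. -/
def DForm.IsSmooth {k : ℕ} (α : DForm n X k) : Prop :=
  ∀ φ ∈ atlas (Cn n) X, ContDiffOn ℝ ∞ (α.inChart φ) φ.target

/-- The value at `x` of a form of top degree, in the frame of `T_x X` given by `stdFrame`. Only
signs and quotients of two such values are used. -/
def DForm.coeffAt {k : ℕ} (α : DForm n X k) (x : X) : ℝ := topCoeff (α x)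

variable (n) in
/-- A function, as a `0`-form. -/
def ofFun (f : X → ℝ) : DForm n X 0 := fun x =>
  ContinuousAlternatingMap.constOfIsEmpty ℝ (Cn n) (Fin 0) (f x)

/-- The wedge product of differential forms. -/
def DForm.wedge {k l : ℕ} (α : DForm n X k) (β : DForm n X l) : DForm n X (k + l) :=
  fun x => GauduchonFactor.wedge (α x) (β x)

/-- The wedge powers of a differential `2`-form. -/
def DForm.pow (α : DForm n X 2) (m : ℕ) : DForm n X (2 * m) := fun x => wedgePow (α x) m

/-- The exterior derivative, computed at `x` in the preferred chart at `x` (whose derivative at `x`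
is the identification of the tangent space at `x` with `ℂⁿ`). -/
def DForm.d {k : ℕ} (α : DForm n X k) : DForm n X (k + 1) := fun x =>
  extDeriv (α.inChart (chartAt (Cn n) x)) (chartAt (Cn n) x x)

/-- Pullback `(v₁, …, vₖ) ↦ α (c J v₁, …, c J vₖ)` of a form by a real multiple of the complex
structure `J` of the tangent spaces. -/
def DForm.compJ {k : ℕ} (c : ℝ) (α : DForm n X k) : DForm n X k := fun x =>
  (α x).compContinuousLinearMap (c • cplxJ n)

/-- The twisted exterior derivative `d^c = (i/2)(∂̄ - ∂)`. On real forms this is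
`½ (J⁻¹)^* ∘ d ∘ J^*`, where `J⁻¹ = -J`: on forms of type `(p, q)` the operator `J^*` is
multiplication by `i ^ (p - q)`. -/
def DForm.dc {k : ℕ} (α : DForm n X k) : DForm n X (k + 1) := fun x =>
  (1 / 2 : ℝ) • ((α.compJ 1).d.compJ (-1)) x

/-- The operator `dd^c = i ∂∂̄`. -/
def DForm.ddc {k : ℕ} (α : DForm n X k) : DForm n X (k + 2) := α.dc.d

end Forms

/-! ### Hermitian metrics -/

/-- A hermitian metric on `X`, given by its fundamental form: a smooth positive
`(1,1)`-form. -/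
structure HermitianMetric (n : ℕ) (X : Type*) [TopologicalSpace X] [ChartedSpace (Cn n) X] where
  form : DForm n X 2
  smooth : form.IsSmooth
  invariant : ∀ (x : X) (u v : Cn n), form x ![cplxJ n u, cplxJ n v] = form x ![u, v]
  pos : ∀ (x : X) (u : Cn n), u ≠ 0 → 0 < form x ![u, cplxJ n u]

variable {n : ℕ} {X : Type*} [TopologicalSpace X] [ChartedSpace (Cn n) X]

variable (n) in
/-- Smooth real valued functions on `X`. -/
def IsSmoothFun (f : X → ℝ) : Prop := ContMDiff 𝓘(ℝ, Cn n) 𝓘(ℝ, ℝ) ∞ f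

namespace HermitianMetric

/-- The complex Laplacian `Δ_ω f = n dd^c f ∧ ω^{n-1} / ω^n`. -/
def laplacian (g : HermitianMetric n X) (f : X → ℝ) (x : X) : ℝ :=
  n * ((ofFun n f).ddc.wedge (g.form.pow (n - 1))).coeffAt x / (g.form.pow n).coeffAt x

/-- The squared norm of the gradient `|df|²_ω = n df ∧ d^c f ∧ ω^{n-1} / ω^n`. -/
def gradSq (g : HermitianMetric n X) (f : X → ℝ) (x : X) : ℝ :=
  n * (((ofFun n f).d.wedge (ofFun n f).dc).wedge (g.form.pow (n - 1))).coeffAt x /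
    (g.form.pow n).coeffAt x

/-- The pointwise inequality `-B ω^n ≤ dd^c ω^{n-1} ≤ B ω^n` between top degree forms. -/
def DdcBound (g : HermitianMetric n X) (B : ℝ) : Prop :=
  ∀ x : X, -B * (g.form.pow n).coeffAt x ≤ (g.form.pow (n - 1)).ddc.coeffAt x ∧
    (g.form.pow (n - 1)).ddc.coeffAt x ≤ B * (g.form.pow n).coeffAt x

variable [MeasurableSpace X]

/-- The measure `ω^n` on `X`. In each chart `φ` the top form `ω^n` gives the measure with density
its coefficient with respect to Lebesgue measure; transported to the domain of `φ`, these measures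
agree on overlaps, and the supremum of the family is the measure obtained by gluing them. -/
def volume (g : HermitianMetric n X) : Measure X :=
  ⨆ φ ∈ atlas (Cn n) X,
    (((MeasureTheory.volume : Measure (Cn n)).restrict φ.target).withDensity fun y =>
      ENNReal.ofReal (topCoeff ((g.form.pow n).inChart φ y))).map φ.symm

/-- `C` is a Sobolev constant: the inequality holds for all smooth functions, hence for the
completion `L²₁(X)` of the space of smooth functions on the compact manifold `X`. -/
def IsSobolevConstant (g : HermitianMetric n X) (C : ℝ) : Prop :=
  ∀ f : X → ℝ, IsSmoothFun n f →
    (∫ x, |f x| ^ (2 * (n : ℝ) / ((n : ℝ) - 1)) ∂g.volume) ^ (((n : ℝ) - 1) / (n : ℝ)) ≤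
      C * ((∫ x, g.gradSq f x ∂g.volume) + ∫ x, |f x| ^ 2 ∂g.volume)

/-- `C` is a Poincaré constant: the inequality holds for all smooth functions of mean zero, hence
for all functions of mean zero in the completion `L²₁(X)`. -/
def IsPoincareConstant (g : HermitianMetric n X) (C : ℝ) : Prop :=
  ∀ f : X → ℝ, IsSmoothFun n f → ∫ x, f x ∂g.volume = 0 →
    ∫ x, |f x| ^ 2 ∂g.volume ≤ C * ∫ x, g.gradSq f x ∂g.volume

/-- `ρ ∈ ker Δ_ω^*`, for the adjoint of `Δ_ω` with respect to the `L²` inner product of `ω^n`: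
`ρ` is smooth and `⟨ρ, Δ_ω f⟩ = 0` for all smooth `f`. -/
def InKerLaplacianAdjoint (g : HermitianMetric n X) (ρ : X → ℝ) : Prop :=
  IsSmoothFun n ρ ∧ ∀ f : X → ℝ, IsSmoothFun n f → ∫ x, ρ x * g.laplacian f x ∂g.volume = 0

end HermitianMetric

end GauduchonFactor

end

/-!
Write `w = log ρ - c` with `c` the mean of `log ρ`. Since `ω` is not closed, integration by parts
against `ω^{n-1}` produces a torsion term: `∫ Δ f ω^n = n ∫ f dd^c ω^{n-1}`. Choosing `F` with
`F' = p e^{(p-1)t}`, the chain rule gives `p e^{pw} |dw|² = Δ e^{pw} - e^w Δ F(w)`, and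
`e^w ∈ ker Δ^*` removes the last term. Hence
`p ∫ e^{pw} |dw|² ω^n = n ∫ (e^{pw} - m) dd^c ω^{n-1}` for all real `p` and `m`, which bounds the
Dirichlet energy of `e^{pw/2}` in terms of the moments of `e^w`.

With the Sobolev inequality this is Moser's iteration: it bounds `sup w` by the moment of order `p`
for a fixed small `p > 0`. With the Poincaré inequality it bounds the moment of order `p` by
`1 + O(p²)` times the normalised square of the moment of order `p / 2`; by repeated halving, and as
`w` has mean zero, the moment of order `p` is then under control for small `|p|`. Since `p` may be
negative, the same holds for `-w`. So `|w| ≤ M`, and `sup ρ ≤ e^{2M} inf ρ`.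
-/

noncomputable section

namespace GauduchonFactor

/-! ### Antisymmetrization -/

section Antisymmetrization

variable {ι κ R V : Type*} [Fintype ι] [DecidableEq ι] [Fintype κ] [DecidableEq κ] [CommRing R]

/-- The antisymmetrization `∑ σ, sign σ * F (v ∘ σ)` of a function of several vectors, not divided
by the number of permutations. It turns identities between wedge products into reindexings. -/
def altSum (F : (ι → V) → R) (v : ι → V) : R :=
  ∑ σ : Equiv.Perm ι, ((Equiv.Perm.sign σ : ℤ) : R) * F (v ∘ σ)

theorem sign_mul_sign_self (τ : Equiv.Perm ι) :
    ((Equiv.Perm.sign τ : ℤ) : R) * ((Equiv.Perm.sign τ : ℤ) : R) = 1 := by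
  rcases Int.units_eq_one_or (Equiv.Perm.sign τ) with h | h <;> simp [h]

theorem altSum_comp_perm (F : (ι → V) → R) (τ : Equiv.Perm ι) (v : ι → V) :
    altSum (fun w => F (w ∘ τ)) v = ((Equiv.Perm.sign τ : ℤ) : R) * altSum F v := by
  unfold altSum
  rw [← Equiv.sum_comp (Equiv.mulRight τ) (fun σ => ((Equiv.Perm.sign σ : ℤ) : R) * F (v ∘ σ)),
    Finset.mul_sum]
  refine Finset.sum_congr rfl fun σ _ => ?_
  simp only [Equiv.coe_mulRight, Equiv.Perm.sign_mul, Units.val_mul, Int.cast_mul,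
    Equiv.Perm.coe_mul, Function.comp_assoc]
  linear_combination
    (-((Equiv.Perm.sign σ : ℤ) : R) * F (v ∘ σ ∘ τ)) * sign_mul_sign_self (R := R) τ

theorem altSum_comp_equiv (e : ι ≃ κ) (F : (ι → V) → R) (v : κ → V) :
    altSum F (v ∘ e) = altSum (fun w => F (w ∘ e)) v := by
  rw [altSum, altSum, ← Equiv.sum_comp e.permCongr]
  refine Finset.sum_congr rfl fun σ _ => ?_
  rw [Equiv.Perm.sign_permCongr]
  congr 2
  funext i
  simp [Equiv.permCongr_apply]

theorem altSum_mul_left (c : R) (F : (ι → V) → R) (v : ι → V) :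
    altSum (fun w => c * F w) v = c * altSum F v := by
  simp only [altSum, Finset.mul_sum, mul_left_comm c]

theorem altSum_add (F G : (ι → V) → R) (v : ι → V) :
    altSum (fun w => F w + G w) v = altSum F v + altSum G v := by
  simp only [altSum, mul_add, Finset.sum_add_distrib]

theorem altSum_sum {J : Type*} (s : Finset J) (F : J → (ι → V) → R) (v : ι → V) :
    altSum (fun w => ∑ j ∈ s, F j w) v = ∑ j ∈ s, altSum (F j) v := by
  simp only [altSum, Finset.mul_sum]
  exact Finset.sum_comm

theorem altSum_absorb (e : Equiv.Perm κ → Equiv.Perm ι)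
    (he : ∀ τ, Equiv.Perm.sign (e τ) = Equiv.Perm.sign τ) (F : (ι → V) → R) (v : ι → V) :
    altSum (fun w => ∑ τ : Equiv.Perm κ, ((Equiv.Perm.sign τ : ℤ) : R) * F (w ∘ e τ)) v =
      ((Fintype.card κ).factorial : R) * altSum F v := by
  have absorb_one (τ : Equiv.Perm κ) :
      altSum (fun w => ((Equiv.Perm.sign τ : ℤ) : R) * F (w ∘ e τ)) v = altSum F v := by
    rw [altSum_mul_left, altSum_comp_perm, he, ← mul_assoc, sign_mul_sign_self, one_mul]
  rw [altSum_sum, Finset.sum_congr rfl fun τ _ => absorb_one τ]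
  simp [Finset.card_univ, Fintype.card_perm]

variable {k l : ℕ}

theorem altSum_absorb_castAdd (F : (Fin k → V) → R) (G : (Fin l → V) → R) (v : Fin (k + l) → V) :
    altSum (fun w => altSum F (w ∘ Fin.castAdd l) * G (w ∘ Fin.natAdd k)) v =
      (k.factorial : R) *
        altSum (fun w => F (w ∘ Fin.castAdd l) * G (w ∘ Fin.natAdd k)) v := by
  have h := altSum_absorb (fun τ => finSumFinEquiv.permCongr (Equiv.Perm.sumCongr τ 1))
    (fun τ => by simp) (fun w => F (w ∘ Fin.castAdd l) * G (w ∘ Fin.natAdd k)) v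
  rw [Fintype.card_fin] at h
  rw [← h]
  congr 1
  funext w
  rw [altSum, Finset.sum_mul]
  refine Finset.sum_congr rfl fun τ _ => ?_
  simp [Function.comp_def, mul_assoc, Equiv.permCongr_apply]

theorem altSum_absorb_natAdd (F : (Fin k → V) → R) (G : (Fin l → V) → R) (v : Fin (k + l) → V) :
    altSum (fun w => F (w ∘ Fin.castAdd l) * altSum G (w ∘ Fin.natAdd k)) v =
      (l.factorial : R) *
        altSum (fun w => F (w ∘ Fin.castAdd l) * G (w ∘ Fin.natAdd k)) v := by
  have h := altSum_absorb (fun τ => finSumFinEquiv.permCongr (Equiv.Perm.sumCongr 1 τ))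
    (fun τ => by simp) (fun w => F (w ∘ Fin.castAdd l) * G (w ∘ Fin.natAdd k)) v
  rw [Fintype.card_fin] at h
  rw [← h]
  congr 1
  funext w
  rw [altSum, Finset.mul_sum]
  refine Finset.sum_congr rfl fun τ _ => ?_
  simp [Function.comp_def, Equiv.permCongr_apply, mul_left_comm]

theorem altSum_absorb_succ (F : V → (Fin k → V) → R) (v : Fin (k + 1) → V) :
    altSum (fun w => altSum (F (w 0)) (w ∘ Fin.succ)) v =
      (k.factorial : R) * altSum (fun w => F (w 0) (w ∘ Fin.succ)) v := by
  have h := altSum_absorb (fun τ => Equiv.Perm.decomposeFin.symm (0, τ))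
    (fun τ => by simp [Equiv.Perm.decomposeFin.symm_sign]) (fun w => F (w 0) (w ∘ Fin.succ)) v
  rw [Fintype.card_fin] at h
  rw [← h]
  rfl

end Antisymmetrization

/-! ### The wedge product -/

section Wedge

variable {V W : Type*} [AddCommGroup V] [Module ℝ V] [TopologicalSpace V]
  [AddCommGroup W] [Module ℝ W] [TopologicalSpace W] {k l : ℕ}

theorem map_comp_perm (α : V [⋀^Fin k]→L[ℝ] ℝ) (v : Fin k → V) (σ : Equiv.Perm (Fin k)) :
    α (v ∘ σ) = Equiv.Perm.sign σ • α v :=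
  α.toAlternatingMap.map_perm v σ

theorem factorial_mul_wedge_apply (α : V [⋀^Fin k]→L[ℝ] ℝ) (β : V [⋀^Fin l]→L[ℝ] ℝ)
    (v : Fin (k + l) → V) :
    (k.factorial : ℝ) * l.factorial * wedge α β v =
      altSum (fun w => α (w ∘ Fin.castAdd l) * β (w ∘ Fin.natAdd k)) v := by
  have h := congrArg (fun f => LinearMap.mul' ℝ ℝ (f (v ∘ finSumFinEquiv)))
    (MultilinearMap.domCoprod_alternization_eq α.toAlternatingMap β.toAlternatingMap)
  simp only [Fintype.card_fin, AlternatingMap.smul_apply, map_nsmul] at h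
  have wedge_eq : wedge α β v = LinearMap.mul' ℝ ℝ
      ((α.toAlternatingMap.domCoprod β.toAlternatingMap) (v ∘ finSumFinEquiv)) := rfl
  rw [wedge_eq, ← Nat.cast_mul, ← nsmul_eq_mul, ← h, MultilinearMap.alternatization_apply, map_sum,
    altSum, ← Equiv.sum_comp finSumFinEquiv.permCongr]
  refine Finset.sum_congr rfl fun σ _ => ?_
  rw [Equiv.Perm.sign_permCongr, Units.smul_def, map_zsmul, zsmul_eq_mul]
  congr 1
  simp [MultilinearMap.domDomCongr_apply, MultilinearMap.domCoprod_apply, Equiv.permCongr_apply,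
    Function.comp_def]

theorem wedge_eq_iff (α : V [⋀^Fin k]→L[ℝ] ℝ) (β : V [⋀^Fin l]→L[ℝ] ℝ) (v : Fin (k + l) → V)
    (c : ℝ) :
    wedge α β v = c ↔
      altSum (fun w => α (w ∘ Fin.castAdd l) * β (w ∘ Fin.natAdd k)) v =
        (k.factorial : ℝ) * l.factorial * c := by
  have h : (k.factorial : ℝ) * l.factorial ≠ 0 := by positivity
  rw [← factorial_mul_wedge_apply, mul_right_inj' h]

theorem wedge_compContinuousLinearMap (α : V [⋀^Fin k]→L[ℝ] ℝ) (β : V [⋀^Fin l]→L[ℝ] ℝ)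
    (L : W →L[ℝ] V) :
    wedge (α.compContinuousLinearMap L) (β.compContinuousLinearMap L) =
      (wedge α β).compContinuousLinearMap L := by
  ext v
  rw [wedge_eq_iff, ContinuousAlternatingMap.compContinuousLinearMap_apply,
    factorial_mul_wedge_apply]
  rfl

theorem wedgePow_compContinuousLinearMap (α : V [⋀^Fin 2]→L[ℝ] ℝ) (L : W →L[ℝ] V) (m : ℕ) :
    wedgePow (α.compContinuousLinearMap L) m = (wedgePow α m).compContinuousLinearMap L := by
  induction m with
  | zero => ext v; rfl
  | succ m ih => rw [wedgePow, ih, wedge_compContinuousLinearMap]; rfl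

theorem wedge_add_left (α α' : V [⋀^Fin k]→L[ℝ] ℝ) (β : V [⋀^Fin l]→L[ℝ] ℝ) :
    wedge (α + α') β = wedge α β + wedge α' β := by
  ext v
  rw [wedge_eq_iff, ContinuousAlternatingMap.add_apply, mul_add, factorial_mul_wedge_apply,
    factorial_mul_wedge_apply, ← altSum_add]
  simp only [ContinuousAlternatingMap.add_apply, add_mul]

theorem wedge_add_right (α : V [⋀^Fin k]→L[ℝ] ℝ) (β β' : V [⋀^Fin l]→L[ℝ] ℝ) :
    wedge α (β + β') = wedge α β + wedge α β' := by
  ext v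
  rw [wedge_eq_iff, ContinuousAlternatingMap.add_apply, mul_add, factorial_mul_wedge_apply,
    factorial_mul_wedge_apply, ← altSum_add]
  simp only [ContinuousAlternatingMap.add_apply, mul_add]

theorem wedge_smul_left (c : ℝ) (α : V [⋀^Fin k]→L[ℝ] ℝ) (β : V [⋀^Fin l]→L[ℝ] ℝ) :
    wedge (c • α) β = c • wedge α β := by
  ext v
  rw [wedge_eq_iff, ContinuousAlternatingMap.smul_apply, smul_eq_mul, mul_left_comm,
    factorial_mul_wedge_apply, ← altSum_mul_left]
  simp only [ContinuousAlternatingMap.smul_apply, smul_eq_mul, mul_assoc]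

theorem wedge_smul_right (c : ℝ) (α : V [⋀^Fin k]→L[ℝ] ℝ) (β : V [⋀^Fin l]→L[ℝ] ℝ) :
    wedge α (c • β) = c • wedge α β := by
  ext v
  rw [wedge_eq_iff, ContinuousAlternatingMap.smul_apply, smul_eq_mul, mul_left_comm,
    factorial_mul_wedge_apply, ← altSum_mul_left]
  simp only [ContinuousAlternatingMap.smul_apply, smul_eq_mul, mul_left_comm]

end Wedge

section NormedWedge

open ContinuousAlternatingMap (alternatizeUncurryFin)

variable {V : Type*} [NormedAddCommGroup V] [NormedSpace ℝ V] {k l : ℕ}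

theorem norm_wedge_apply_le (α : V [⋀^Fin k]→L[ℝ] ℝ) (β : V [⋀^Fin l]→L[ℝ] ℝ)
    (v : Fin (k + l) → V) :
    ‖wedge α β v‖ ≤ (k + l).factorial * ‖α‖ * ‖β‖ * ∏ i, ‖v i‖ := by
  have summand_le (σ : Equiv.Perm (Fin (k + l))) : ‖((Equiv.Perm.sign σ : ℤ) : ℝ) *
      (α ((v ∘ σ) ∘ Fin.castAdd l) * β ((v ∘ σ) ∘ Fin.natAdd k))‖ ≤ ‖α‖ * ‖β‖ * ∏ i, ‖v i‖ := by
    have norm_sign : ‖((Equiv.Perm.sign σ : ℤ) : ℝ)‖ = 1 := by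
      rcases Int.units_eq_one_or (Equiv.Perm.sign σ) with h | h <;> simp [h]
    rw [norm_mul, norm_sign, one_mul, norm_mul, ← Equiv.prod_comp σ, Fin.prod_univ_add]
    calc _ ≤ (‖α‖ * ∏ i, ‖v (σ (Fin.castAdd l i))‖) * (‖β‖ * ∏ i, ‖v (σ (Fin.natAdd k i))‖) :=
          mul_le_mul (α.le_opNorm _) (β.le_opNorm _) (norm_nonneg _) (by positivity)
      _ = _ := by ring
  have one_le : (1 : ℝ) ≤ (k.factorial : ℝ) * l.factorial := by
    exact_mod_cast Nat.one_le_iff_ne_zero.2 (by positivity)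
  calc ‖wedge α β v‖ ≤ (k.factorial : ℝ) * l.factorial * ‖wedge α β v‖ :=
        le_mul_of_one_le_left (norm_nonneg _) one_le
    _ = ‖altSum (fun w => α (w ∘ Fin.castAdd l) * β (w ∘ Fin.natAdd k)) v‖ := by
        rw [← factorial_mul_wedge_apply, norm_mul, norm_mul, Real.norm_natCast, Real.norm_natCast]
    _ ≤ ∑ _σ : Equiv.Perm (Fin (k + l)), ‖α‖ * ‖β‖ * ∏ i, ‖v i‖ :=
        norm_sum_le_of_le _ fun σ _ => summand_le σ
    _ = (k + l).factorial * ‖α‖ * ‖β‖ * ∏ i, ‖v i‖ := by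
        simp [Finset.card_univ, Fintype.card_perm, mul_assoc]

variable (V) in
/-- The wedge product as a continuous bilinear map. -/
def wedgeL (k l : ℕ) :
    (V [⋀^Fin k]→L[ℝ] ℝ) →L[ℝ] (V [⋀^Fin l]→L[ℝ] ℝ) →L[ℝ] V [⋀^Fin (k + l)]→L[ℝ] ℝ :=
  LinearMap.mkContinuous₂
    (LinearMap.mk₂ ℝ wedge wedge_add_left wedge_smul_left wedge_add_right wedge_smul_right)
    (k + l).factorial fun α β =>
      ContinuousAlternatingMap.opNorm_le_bound _ (by positivity) (norm_wedge_apply_le α β)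

@[simp]
theorem wedgeL_apply (α : V [⋀^Fin k]→L[ℝ] ℝ) (β : V [⋀^Fin l]→L[ℝ] ℝ) :
    wedgeL V k l α β = wedge α β := rfl

theorem sign_decomposeFin_mul_apply_comp (a : V [⋀^Fin k]→L[ℝ] ℝ) (v : Fin (k + 1) → V)
    (p : Fin (k + 1)) (τ : Equiv.Perm (Fin k)) :
    ((Equiv.Perm.sign (Equiv.Perm.decomposeFin.symm (p, τ)) : ℤ) : ℝ) *
      a ((v ∘ Equiv.Perm.decomposeFin.symm (p, τ)) ∘ Fin.succ) =
    (-1) ^ (p : ℕ) * a (p.removeNth v) := by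
  have comp_succ : (v ∘ Equiv.Perm.decomposeFin.symm (p, τ)) ∘ Fin.succ =
      (fun i => v (Equiv.swap 0 p i.succ)) ∘ τ := by
    funext i; simp
  have hs := sign_mul_sign_self (R := ℝ) τ
  rw [comp_succ, map_comp_perm, Equiv.Perm.decomposeFin.symm_sign]
  induction p using Fin.cases with
  | zero =>
    simp only [if_true, one_mul, Equiv.swap_self, Units.smul_def, zsmul_eq_mul, ← mul_assoc, hs]
    simp [Fin.tail_def]
  | succ i =>
    have comp_swap : (fun j : Fin k => v (Equiv.swap 0 i.succ j.succ)) =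
        (i.succ.removeNth v) ∘ i.cycleRange := by
      funext j
      simp [Fin.removeNth, Fin.succAbove_cycleRange]
    rw [comp_swap, map_comp_perm, if_neg (Fin.succ_ne_zero i), Fin.sign_cycleRange]
    simp only [Units.smul_def, zsmul_eq_mul, Units.val_mul, Int.cast_mul, Units.val_neg,
      Units.val_one, Int.cast_neg, Int.cast_one, Units.val_pow_eq_pow_val, Int.cast_pow,
      Fin.val_succ, pow_succ]
    linear_combination (-(-1 : ℝ) ^ (i : ℕ) * a (i.succ.removeNth v)) * hs

theorem factorial_mul_alternatizeUncurryFin_apply (A : V →L[ℝ] V [⋀^Fin k]→L[ℝ] ℝ)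
    (v : Fin (k + 1) → V) :
    (k.factorial : ℝ) * alternatizeUncurryFin A v =
      altSum (fun w => A (w 0) (w ∘ Fin.succ)) v := by
  rw [ContinuousAlternatingMap.alternatizeUncurryFin_apply, altSum, Finset.univ_perm_fin_succ,
    ← Finset.univ_product_univ]
  simp only [Finset.sum_map, Equiv.toEmbedding_apply, Finset.sum_product, Finset.mul_sum]
  refine Finset.sum_congr rfl fun p _ => ?_
  have summand_eq (τ : Equiv.Perm (Fin k)) :
      ((Equiv.Perm.sign (Equiv.Perm.decomposeFin.symm (p, τ)) : ℤ) : ℝ) *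
        A ((v ∘ Equiv.Perm.decomposeFin.symm (p, τ)) 0)
          ((v ∘ Equiv.Perm.decomposeFin.symm (p, τ)) ∘ Fin.succ) =
      (-1) ^ (p : ℕ) * A (v p) (p.removeNth v) := by
    rw [sign_decomposeFin_mul_apply_comp, Function.comp_apply,
      Equiv.Perm.decomposeFin_symm_apply_zero]
  rw [Finset.sum_congr rfl fun τ _ => summand_eq τ]
  simp [Finset.card_univ, Fintype.card_perm]

theorem factorial_mul_alternatizeUncurryFin_of_eq_wedge {a : V → V [⋀^Fin k]→L[ℝ] ℝ}
    {b : V → V [⋀^Fin l]→L[ℝ] ℝ} (C : V →L[ℝ] V [⋀^Fin (k + l)]→L[ℝ] ℝ)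
    (hC : ∀ u, C u = wedge (a u) (b u)) (v : Fin (k + l + 1) → V) :
    (k.factorial : ℝ) * l.factorial * alternatizeUncurryFin C v =
      altSum (fun w => a (w 0) ((w ∘ Fin.succ) ∘ Fin.castAdd l) *
        b (w 0) ((w ∘ Fin.succ) ∘ Fin.natAdd k)) v := by
  have hkl : ((k + l).factorial : ℝ) ≠ 0 := by positivity
  apply mul_left_cancel₀ hkl
  rw [← altSum_absorb_succ (fun u w => a u (w ∘ Fin.castAdd l) * b u (w ∘ Fin.natAdd k)),
    mul_left_comm, factorial_mul_alternatizeUncurryFin_apply, ← altSum_mul_left]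
  simp only [hC, factorial_mul_wedge_apply]

theorem factorial_mul_wedge_alternatizeUncurryFin_left (A : V →L[ℝ] V [⋀^Fin k]→L[ℝ] ℝ)
    (β : V [⋀^Fin l]→L[ℝ] ℝ) (v : Fin (k + 1 + l) → V) :
    (k.factorial : ℝ) * l.factorial * wedge (alternatizeUncurryFin A) β v =
      altSum (fun w => A (w (Fin.castAdd l 0)) ((w ∘ Fin.castAdd l) ∘ Fin.succ) *
        β (w ∘ Fin.natAdd (k + 1))) v := by
  have hk : ((k + 1).factorial : ℝ) ≠ 0 := by positivity
  apply mul_left_cancel₀ hk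
  refine Eq.trans ?_ (altSum_absorb_castAdd (fun w => A (w 0) (w ∘ Fin.succ)) β v)
  rw [mul_assoc, mul_left_comm, ← mul_assoc ((k + 1).factorial : ℝ), factorial_mul_wedge_apply,
    ← altSum_mul_left]
  simp only [← mul_assoc, factorial_mul_alternatizeUncurryFin_apply]

theorem factorial_mul_wedge_alternatizeUncurryFin_right (α : V [⋀^Fin k]→L[ℝ] ℝ)
    (B : V →L[ℝ] V [⋀^Fin l]→L[ℝ] ℝ) (v : Fin (k + (l + 1)) → V) :
    (k.factorial : ℝ) * l.factorial * wedge α (alternatizeUncurryFin B) v =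
      altSum (fun w => α (w ∘ Fin.castAdd (l + 1)) *
        B (w (Fin.natAdd k 0)) ((w ∘ Fin.natAdd k) ∘ Fin.succ)) v := by
  have hl : ((l + 1).factorial : ℝ) ≠ 0 := by positivity
  apply mul_left_cancel₀ hl
  refine Eq.trans ?_ (altSum_absorb_natAdd α (fun w => B (w 0) (w ∘ Fin.succ)) v)
  have wedge_apply := factorial_mul_wedge_apply α (alternatizeUncurryFin B) v
  calc ((l + 1).factorial : ℝ) * (k.factorial * l.factorial * wedge α (alternatizeUncurryFin B) v)
      = l.factorial * altSum (fun w => α (w ∘ Fin.castAdd (l + 1)) *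
          alternatizeUncurryFin B (w ∘ Fin.natAdd k)) v := by
        rw [← wedge_apply]
        ring
    _ = _ := by
        rw [← altSum_mul_left]
        simp only [mul_left_comm (l.factorial : ℝ), factorial_mul_alternatizeUncurryFin_apply]

/-- `λ ∧ (α ∧ β) = (λ ∧ α) ∧ β`, extended linearly in `λ ⊗ α`. -/
theorem alternatizeUncurryFin_wedge_left (A : V →L[ℝ] V [⋀^Fin k]→L[ℝ] ℝ)
    (β : V [⋀^Fin l]→L[ℝ] ℝ) (v : Fin (k + 1 + l) → V) :
    alternatizeUncurryFin (((wedgeL V k l).flip β).comp A)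
        (v ∘ Fin.cast (Nat.add_right_comm k l 1)) =
      wedge (alternatizeUncurryFin A) β v := by
  have hkl : (k.factorial : ℝ) * l.factorial ≠ 0 := by positivity
  apply mul_left_cancel₀ hkl
  rw [factorial_mul_wedge_alternatizeUncurryFin_left,
    factorial_mul_alternatizeUncurryFin_of_eq_wedge (a := A) (b := fun _ => β) _ fun _ => rfl]
  refine (altSum_comp_equiv (finCongr (Nat.add_right_comm k l 1)) _ v).trans ?_
  refine congrArg (altSum · v) (funext fun w => congrArg (_ * ·) (congrArg β (funext fun i => ?_)))
  refine congrArg w (Fin.ext ?_)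
  simp only [finCongr_apply, Fin.val_cast, Fin.val_succ, Fin.val_natAdd]
  exact Nat.add_right_comm k i 1

/-- `λ ∧ (α ∧ β) = (-1)ᵏ α ∧ (λ ∧ β)`, extended linearly in `λ ⊗ β`. -/
theorem alternatizeUncurryFin_wedge_right (α : V [⋀^Fin k]→L[ℝ] ℝ)
    (B : V →L[ℝ] V [⋀^Fin l]→L[ℝ] ℝ) (v : Fin (k + l + 1) → V) :
    alternatizeUncurryFin ((wedgeL V k l α).comp B) v =
      (-1) ^ k * wedge α (alternatizeUncurryFin B) v := by
  have hkl : (k.factorial : ℝ) * l.factorial ≠ 0 := by positivity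
  apply mul_left_cancel₀ hkl
  rw [mul_left_comm, factorial_mul_wedge_alternatizeUncurryFin_right,
    factorial_mul_alternatizeUncurryFin_of_eq_wedge (a := fun _ => α) (b := B) _ fun _ => rfl]
  set c : Fin (k + (l + 1)) := Fin.natAdd k 0
  have c_val : (c : ℕ) = k := rfl
  have cast_sign : (((Equiv.Perm.sign c.cycleRange : ℤˣ) : ℤ) : ℝ) = (-1) ^ k := by
    rw [Fin.sign_cycleRange]
    simp [c_val]
  have cycle_castAdd (i : Fin k) :
      c.cycleRange (Fin.castAdd (l + 1) i) = (Fin.castAdd l i).succ :=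
    Fin.ext (Fin.coe_cycleRange_of_lt (Fin.lt_def.2 i.isLt))
  have cycle_natAdd (i : Fin l) :
      c.cycleRange (Fin.natAdd k i.succ) = (Fin.natAdd k i).succ :=
    Fin.cycleRange_of_gt (Fin.lt_def.2 (by simp [c_val]))
  rw [← cast_sign, ← altSum_comp_perm]
  refine congrArg (altSum · v) (funext fun w => congrArg₂ (· * ·) ?_ ?_)
  · exact congrArg α (funext fun i => congrArg w (cycle_castAdd i).symm)
  · exact congrArg₂ (fun u x => B u x) (congrArg w (Fin.cycleRange_self c).symm)
      (funext fun i => congrArg w (cycle_natAdd i).symm)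

theorem alternatizeUncurryFin_smulRight (lam : V →L[ℝ] ℝ) (α : V [⋀^Fin 1]→L[ℝ] ℝ)
    (hα : ∀ w, α w = lam (w 0)) (β : V [⋀^Fin l]→L[ℝ] ℝ) (v : Fin (1 + l) → V) :
    alternatizeUncurryFin (lam.smulRight β) (v ∘ Fin.cast (Nat.add_comm l 1)) = wedge α β v := by
  refine Eq.symm ((wedge_eq_iff _ _ _ _).2 ?_)
  rw [Nat.factorial_one, Nat.cast_one, one_mul, factorial_mul_alternatizeUncurryFin_apply]
  refine Eq.trans ?_ (altSum_comp_equiv (finCongr (Nat.add_comm l 1)) _ v).symm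
  congr! 3 with w
  simp only [hα, ContinuousLinearMap.smulRight_apply, ContinuousAlternatingMap.smul_apply,
    smul_eq_mul]
  congr! 2
  funext i
  refine congrArg w (Fin.ext ?_)
  simp only [finCongr_apply, Fin.val_cast, Fin.val_succ, Fin.val_natAdd, Nat.add_comm]

end NormedWedge

/-! ### Top degree forms on `ℂⁿ` -/

section TopDegree

/-- The bijection `(i, a) ↦ 2 i + a`, numbering the real basis `e₁, i e₁, …, eₙ, i eₙ` of `ℂⁿ`. -/
def pairEquiv (n : ℕ) : Fin n × Fin 2 ≃ Fin (2 * n) :=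
  finProdFinEquiv.trans (finCongr (mul_comm n 2))

theorem pairEquiv_val {n : ℕ} (p : Fin n × Fin 2) : (pairEquiv n p : ℕ) = p.2 + 2 * p.1 := rfl

/-- The real basis `e₁, i e₁, …, eₙ, i eₙ` of `ℂⁿ`. -/
def stdBasis (n : ℕ) : Module.Basis (Fin (2 * n)) ℝ (Cn n) :=
  (Pi.basis fun _ : Fin n => Complex.basisOneI).reindex
    ((Equiv.sigmaEquivProd (Fin n) (Fin 2)).trans (pairEquiv n))

theorem stdFrame_pairEquiv {n : ℕ} (p : Fin n × Fin 2) :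
    stdFrame n (2 * n) (pairEquiv n p) = Pi.single p.1 (Complex.basisOneI p.2) := by
  obtain ⟨i, a⟩ := p
  funext j
  have div_two : (pairEquiv n (i, a) : ℕ) / 2 = i := by rw [pairEquiv_val]; simp only; omega
  have mod_two : (pairEquiv n (i, a) : ℕ) % 2 = a := by rw [pairEquiv_val]; simp only; omega
  simp only [stdFrame, div_two, mod_two, Pi.single_apply, Fin.ext_iff]
  split_ifs with _ ha
  · have : a = 0 := Fin.ext ha
    simp [this]
  · have : a = 1 := by omega
    simp [this]
  · rfl

theorem coe_stdBasis (n : ℕ) : ⇑(stdBasis n) = stdFrame n (2 * n) := by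
  funext c
  obtain ⟨p, rfl⟩ := (pairEquiv n).surjective c
  rw [stdFrame_pairEquiv, stdBasis, Module.Basis.reindex_apply]
  simp [Pi.basis_apply]

theorem topCoeff_compContinuousLinearMap {n k : ℕ} (hk : k = 2 * n)
    (α : Cn n [⋀^Fin k]→L[ℝ] ℝ) (L : Cn n →L[ℝ] Cn n) :
    topCoeff (α.compContinuousLinearMap L) =
      LinearMap.det (L : Cn n →ₗ[ℝ] Cn n) * topCoeff α := by
  subst hk
  have apply_eq (v : Fin (2 * n) → Cn n) : α v = α (stdBasis n) * (stdBasis n).det v := by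
    simpa using DFunLike.congr_fun (α.toAlternatingMap.eq_smul_basis_det (stdBasis n)) v
  have det_comp := (stdBasis n).det_comp (L : Cn n →ₗ[ℝ] Cn n) (stdBasis n)
  rw [Module.Basis.det_self, mul_one] at det_comp
  change α (L ∘ stdFrame n (2 * n)) = _ * α (stdFrame n (2 * n))
  rw [← coe_stdBasis, apply_eq, mul_comm]
  exact congrArg (· * _) det_comp

theorem det_restrictScalars_eq_normSq {V : Type*} [AddCommGroup V] [Module ℂ V] [Module ℝ V]
    [IsScalarTower ℝ ℂ V] (L : V →ₗ[ℂ] V) :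
    LinearMap.det (L.restrictScalars ℝ) = Complex.normSq (LinearMap.det L) := by
  rw [LinearMap.det_restrictScalars, Algebra.norm_complex_apply]

theorem cplxJ_apply {n : ℕ} (u : Cn n) : cplxJ n u = Complex.I • u := rfl

theorem cplxJ_cplxJ {n : ℕ} (u : Cn n) : cplxJ n (cplxJ n u) = -u := by
  simp only [cplxJ_apply, smul_smul, Complex.I_mul_I, neg_smul, one_smul]

theorem smul_eq_re_smul_add_im_smul_cplxJ {n : ℕ} (z : ℂ) (u : Cn n) :
    z • u = z.re • u + z.im • cplxJ n u := by
  funext j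
  simp only [cplxJ_apply, Pi.smul_apply, Pi.add_apply, smul_eq_mul, Complex.real_smul]
  linear_combination -(u j) * Complex.re_add_im z

theorem det_cplxJ (n : ℕ) : LinearMap.det (cplxJ n : Cn n →ₗ[ℝ] Cn n) = 1 := by
  have h : (cplxJ n : Cn n →ₗ[ℝ] Cn n) =
      (Complex.I • (LinearMap.id : Cn n →ₗ[ℂ] Cn n)).restrictScalars ℝ := rfl
  rw [h, det_restrictScalars_eq_normSq, LinearMap.det_smul]
  simp

end TopDegree

/-! ### Two-forms and their wedge powers -/

section Pair

variable {V W : Type*} [AddCommGroup V] [Module ℝ V] [TopologicalSpace V]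
  [AddCommGroup W] [Module ℝ W] [TopologicalSpace W] (η : V [⋀^Fin 2]→L[ℝ] ℝ)

theorem map_eq_map_pair (w : Fin 2 → V) : η w = η ![w 0, w 1] :=
  congrArg η (FinVec.etaExpand_eq w).symm

theorem map_pair_swap (u v : V) : η ![u, v] = -η ![v, u] := by
  have h := map_comp_perm η ![v, u] (Equiv.swap 0 1)
  have comp_swap : ![v, u] ∘ Equiv.swap (0 : Fin 2) 1 = ![u, v] := by
    funext i; fin_cases i <;> simp
  rw [Equiv.Perm.sign_swap (by simp), comp_swap] at h
  simpa using h

theorem map_pair_add_left (u u' v : V) : η ![u + u', v] = η ![u, v] + η ![u', v] :=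
  η.vecCons_add ![v] u u'

theorem map_pair_smul_left (c : ℝ) (u v : V) : η ![c • u, v] = c * η ![u, v] :=
  η.vecCons_smul ![v] c u

theorem map_pair_neg_left (u v : V) : η ![-u, v] = -η ![u, v] := by
  rw [← neg_one_smul ℝ u, map_pair_smul_left, neg_one_mul]

theorem compContinuousLinearMap_pair (L : W →L[ℝ] V) (u v : W) :
    η.compContinuousLinearMap L ![u, v] = η ![L u, L v] := by
  rw [ContinuousAlternatingMap.compContinuousLinearMap_apply, map_eq_map_pair]
  rfl

theorem wedgePow_apply_eq_altSum {b : V → V → ℝ} (hb : ∀ u v, η ![u, v] = b u v - b v u)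
    (m : ℕ) (v : Fin (2 * m) → V) :
    wedgePow η m v =
      altSum (fun w => ∏ i, b (w (pairEquiv m (i, 0))) (w (pairEquiv m (i, 1)))) v := by
  have apply_eq (w : Fin 2 → V) : η w = altSum (fun w : Fin 2 → V => b (w 0) (w 1)) w := by
    have univ_eq : (Finset.univ : Finset (Equiv.Perm (Fin 2))) = {1, Equiv.swap 0 1} := by decide
    have one_ne_swap : (1 : Equiv.Perm (Fin 2)) ≠ Equiv.swap 0 1 := by decide
    rw [map_eq_map_pair, hb, altSum, univ_eq, Finset.sum_pair one_ne_swap,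
      Equiv.Perm.sign_swap (by simp)]
    simp [sub_eq_add_neg]
  induction m with
  | zero => simp [altSum, wedgePow]
  | succ m ih =>
    change wedge (wedgePow η m) η v = _
    rw [wedge_eq_iff]
    simp_rw [ih, apply_eq]
    rw [altSum_absorb_castAdd (fun w => ∏ i, b (w (pairEquiv m (i, 0))) (w (pairEquiv m (i, 1)))),
      altSum_absorb_natAdd
        (fun w : Fin (2 * m) → V => ∏ i, b (w (pairEquiv m (i, 0))) (w (pairEquiv m (i, 1)))),
      ← mul_assoc]
    refine congrArg (_ * altSum · v) (funext fun w => ?_)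
    have pairEquiv_last (a : Fin 2) : pairEquiv (m + 1) (Fin.last m, a) = Fin.natAdd (2 * m) a :=
      Fin.ext (Nat.add_comm _ _)
    rw [Fin.prod_univ_castSucc, pairEquiv_last, pairEquiv_last]
    rfl

end Pair

/-! ### Positive `(1,1)`-forms -/

section Positivity

variable {n : ℕ}

/-- Positive real `(1,1)`-forms on `ℂⁿ`: the values of the fundamental form of a hermitian metric.
Type `(1,1)` is encoded as invariance under the complex structure. -/
structure IsPositive (η : Cn n [⋀^Fin 2]→L[ℝ] ℝ) : Prop where
  invariant : ∀ u v, η ![cplxJ n u, cplxJ n v] = η ![u, v]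
  pos : ∀ u, u ≠ 0 → 0 < η ![u, cplxJ n u]

namespace IsPositive

variable {η : Cn n [⋀^Fin 2]→L[ℝ] ℝ} (hη : IsPositive η)

include hη

theorem apply_cplxJ_left (u v : Cn n) : η ![cplxJ n u, v] = -η ![u, cplxJ n v] := by
  rw [← hη.invariant, cplxJ_cplxJ, map_pair_neg_left]

theorem apply_cplxJ_symm (u v : Cn n) : η ![u, cplxJ n v] = η ![v, cplxJ n u] := by
  rw [map_pair_swap, hη.apply_cplxJ_left, neg_neg]

theorem compContinuousLinearMap_cplxJ : η.compContinuousLinearMap (cplxJ n) = η := by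
  ext w
  rw [map_eq_map_pair, compContinuousLinearMap_pair, hη.invariant, ← map_eq_map_pair]

/-- The hermitian inner product `⟨u, v⟩ = η(u, Jv) + i η(u, v)` of a positive `(1,1)`-form; it is
antilinear in `u`. -/
abbrev innerProductCore : InnerProductSpace.Core ℂ (Cn n) where
  inner u v := ⟨η ![u, cplxJ n v], η ![u, v]⟩
  conj_inner_symm u v :=
    Complex.ext (hη.apply_cplxJ_symm v u) (map_pair_swap η u v).symm
  re_inner_nonneg u := by
    rcases eq_or_ne u 0 with rfl | hu
    · exact (η.map_coord_zero 0 rfl).ge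
    · exact (hη.pos u hu).le
  add_left u v w := Complex.ext (map_pair_add_left η u v _) (map_pair_add_left η u v w)
  smul_left u v r := by
    apply Complex.ext
    · simp only [smul_eq_re_smul_add_im_smul_cplxJ r, map_pair_add_left, map_pair_smul_left,
        hη.invariant, Complex.mul_re, Complex.conj_re, Complex.conj_im]
      ring
    · simp only [smul_eq_re_smul_add_im_smul_cplxJ r, map_pair_add_left, map_pair_smul_left,
        hη.apply_cplxJ_left, Complex.mul_im, Complex.conj_re, Complex.conj_im]
      ring
  definite u h := by
    by_contra hu
    exact (hη.pos u hu).ne' (congrArg Complex.re h)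

end IsPositive

theorem altSum_prod_re_mul_im_stdFrame (κ : Fin n → Fin n) :
    altSum (fun w : Fin (2 * n) → Cn n => ∏ i,
      ((w (pairEquiv n (i, 0)) (κ i)).re * (w (pairEquiv n (i, 1)) (κ i)).im))
      (stdFrame n (2 * n)) =
    (Matrix.of fun j i => if κ i = j then (1 : ℝ) else 0).det ^ 2 := by
  let P : Matrix (Fin n) (Fin n) ℝ := Matrix.of fun j i => if κ i = j then (1 : ℝ) else 0
  have det_kronecker :
      (Matrix.kroneckerMap (· * ·) P (1 : Matrix (Fin 2) (Fin 2) ℝ)).det = P.det ^ 2 := by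
    rw [Matrix.det_kronecker]; simp
  rw [← det_kronecker, ← Matrix.det_submatrix_equiv_self (pairEquiv n).symm, Matrix.det_apply',
    altSum]
  refine Finset.sum_congr rfl fun σ _ => congrArg (_ * ·) ?_
  rw [← Equiv.prod_comp (pairEquiv n), Fintype.prod_prod_type]
  refine Finset.prod_congr rfl fun i _ => ?_
  rw [Fin.prod_univ_two, Function.comp_apply, Function.comp_apply]
  generalize σ (pairEquiv n (i, 0)) = s
  generalize σ (pairEquiv n (i, 1)) = t
  obtain ⟨⟨s, a⟩, rfl⟩ := (pairEquiv n).surjective s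
  obtain ⟨⟨t, b⟩, rfl⟩ := (pairEquiv n).surjective t
  rw [stdFrame_pairEquiv, stdFrame_pairEquiv]
  simp only [Matrix.submatrix_apply, Equiv.symm_apply_apply, Matrix.kroneckerMap_apply, P,
    Matrix.of_apply, Matrix.one_apply, Pi.single_apply]
  congr 1
  · fin_cases a <;> split_ifs <;> simp_all
  · fin_cases b <;> split_ifs <;> simp_all

theorem topCoeff_wedgePow_pos_of_eq_sum (η : Cn n [⋀^Fin 2]→L[ℝ] ℝ)
    (hη : ∀ u v, η ![u, v] = ∑ k, (u k).re * (v k).im - ∑ k, (v k).re * (u k).im) :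
    0 < topCoeff (wedgePow η n) := by
  have topCoeff_eq : topCoeff (wedgePow η n) =
      ∑ κ : Fin n → Fin n, (Matrix.of fun j i => if κ i = j then (1 : ℝ) else 0).det ^ 2 := by
    rw [topCoeff, wedgePow_apply_eq_altSum η hη]
    simp_rw [Finset.prod_univ_sum]
    rw [altSum_sum, Fintype.piFinset_univ]
    simp_rw [altSum_prod_re_mul_im_stdFrame]
  have matrix_id : (Matrix.of fun j i : Fin n => if id i = j then (1 : ℝ) else 0) = 1 := by
    ext i j; simp [Matrix.one_apply, eq_comm]
  calc (0 : ℝ) < (Matrix.of fun j i : Fin n => if id i = j then (1 : ℝ) else 0).det ^ 2 := by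
        rw [matrix_id]; simp
    _ ≤ ∑ κ : Fin n → Fin n, (Matrix.of fun j i => if κ i = j then (1 : ℝ) else 0).det ^ 2 :=
        Finset.single_le_sum (f := fun κ : Fin n → Fin n =>
          (Matrix.of fun j i => if κ i = j then (1 : ℝ) else 0).det ^ 2)
          (fun κ _ => sq_nonneg _) (Finset.mem_univ id)
    _ = _ := topCoeff_eq.symm

theorem exists_orthonormal_basis_of_core {V : Type*} [AddCommGroup V] [Module ℂ V]
    [FiniteDimensional ℂ V] (hn : Module.finrank ℂ V = n) (c : InnerProductSpace.Core ℂ V) :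
    ∃ b : Module.Basis (Fin n) ℂ V, ∀ u w : Fin n → ℂ,
      c.inner (b.equivFun.symm u) (b.equivFun.symm w) = ∑ k, (starRingEnd ℂ) (u k) * w k := by
  let := c.toNormedAddCommGroup
  let := InnerProductSpace.ofCore c.toCore
  subst hn
  refine ⟨(stdOrthonormalBasis ℂ V).toBasis, fun u w => ?_⟩
  have orthonormal := orthonormal_iff_ite.1 (stdOrthonormalBasis ℂ V).orthonormal
  change inner ℂ _ _ = _
  rw [Module.Basis.equivFun_symm_apply, Module.Basis.equivFun_symm_apply, sum_inner]
  refine Finset.sum_congr rfl fun k _ => ?_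
  rw [inner_sum]
  simp [inner_smul_left, inner_smul_right, orthonormal, mul_comm]

theorem IsPositive.topCoeff_wedgePow_pos {η : Cn n [⋀^Fin 2]→L[ℝ] ℝ} (hη : IsPositive η) :
    0 < topCoeff (wedgePow η n) := by
  obtain ⟨b, hb⟩ := exists_orthonormal_basis_of_core (n := n) (by simp) hη.innerProductCore
  let e : Cn n ≃ₗ[ℂ] Cn n := b.equivFun.symm
  let L : Cn n →L[ℝ] Cn n := LinearMap.toContinuousLinearMap (e.toLinearMap.restrictScalars ℝ)
  have pos : 0 < topCoeff (wedgePow (η.compContinuousLinearMap L) n) := by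
    refine topCoeff_wedgePow_pos_of_eq_sum _ fun u v => ?_
    have im_inner : η ![L u, L v] = (∑ k, (starRingEnd ℂ) (u k) * v k).im :=
      congrArg Complex.im (hb u v)
    rw [compContinuousLinearMap_pair, im_inner, Complex.im_sum, ← Finset.sum_sub_distrib]
    refine Finset.sum_congr rfl fun k _ => ?_
    simp only [Complex.mul_im, Complex.conj_re, Complex.conj_im]
    ring
  have det_L : LinearMap.det (L : Cn n →ₗ[ℝ] Cn n) = Complex.normSq (LinearMap.det e.toLinearMap) :=
    det_restrictScalars_eq_normSq _
  rw [wedgePow_compContinuousLinearMap, topCoeff_compContinuousLinearMap rfl, det_L] at pos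
  exact pos_of_mul_pos_right pos (Complex.normSq_nonneg _)

end Positivity

/-! ### Exterior calculus on a normed space -/

section FlatCalculus

open ContinuousAlternatingMap (alternatizeUncurryFin constOfIsEmpty)

variable {E V W : Type*} [NormedAddCommGroup E] [NormedSpace ℝ E] [NormedAddCommGroup V]
  [NormedSpace ℝ V] [NormedAddCommGroup W] [NormedSpace ℝ W] {k l : ℕ} {r : ℕ∞ω}

theorem contDiff_of_contDiffAt_tsupport {f : E → V}
    (hf : ∀ y ∈ tsupport f, ContDiffAt ℝ r f y) : ContDiff ℝ r f := by
  refine contDiff_iff_contDiffAt.2 fun y => ?_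
  by_cases hy : y ∈ tsupport f
  · exact hf y hy
  · exact contDiffAt_const.congr_of_eventuallyEq (notMem_tsupport_iff_eventuallyEq.1 hy)

theorem contDiffAt_wedge {α : E → V [⋀^Fin k]→L[ℝ] ℝ} {β : E → V [⋀^Fin l]→L[ℝ] ℝ} {y : E}
    (hα : ContDiffAt ℝ r α y) (hβ : ContDiffAt ℝ r β y) :
    ContDiffAt ℝ r (fun z => wedge (α z) (β z)) y := by
  have h : ContDiff ℝ r (wedgeL V k l) :=
    ContinuousLinearMap.contDiff (𝕜 := ℝ) (E := V [⋀^Fin k]→L[ℝ] ℝ)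
      (F := (V [⋀^Fin l]→L[ℝ] ℝ) →L[ℝ] V [⋀^Fin (k + l)]→L[ℝ] ℝ) (wedgeL V k l)
  exact (h.contDiffAt.comp y hα).clm_apply hβ

theorem contDiffAt_wedgePow {η : E → V [⋀^Fin 2]→L[ℝ] ℝ} {y : E} (hη : ContDiffAt ℝ r η y)
    (m : ℕ) : ContDiffAt ℝ r (fun z => wedgePow (η z) m) y := by
  induction m with
  | zero => exact contDiffAt_const
  | succ m ih => exact contDiffAt_wedge ih hη

variable (V) in
theorem contDiffAt_constOfIsEmpty {f : E → ℝ} {y : E} (hf : ContDiffAt ℝ r f y) :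
    ContDiffAt ℝ r (fun z => constOfIsEmpty ℝ V (Fin 0) (f z)) y :=
  (ContinuousAlternatingMap.constOfIsEmptyLIE ℝ V ℝ (Fin 0)).contDiff.contDiffAt.comp y hf

theorem contDiffAt_compContinuousLinearMap_const {α : E → V [⋀^Fin k]→L[ℝ] ℝ} {y : E}
    (hα : ContDiffAt ℝ r α y) (L : W →L[ℝ] V) :
    ContDiffAt ℝ r (fun z => (α z).compContinuousLinearMap L) y := by
  have h := (ContinuousAlternatingMap.compContinuousLinearMapCLM (𝕜 := ℝ) (ι := Fin k) (F := ℝ)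
    L).contDiff (n := r)
  exact h.contDiffAt.comp y hα

theorem contDiffAt_extDeriv {α : V → V [⋀^Fin k]→L[ℝ] ℝ} {y : V} (hα : ContDiffAt ℝ ∞ α y) :
    ContDiffAt ℝ ∞ (extDeriv α) y :=
  (ContinuousAlternatingMap.alternatizeUncurryFinCLM ℝ V ℝ).contDiff.contDiffAt.comp y
    (hα.fderiv_right (by simp))

theorem extDeriv_wedge_apply {α : V → V [⋀^Fin k]→L[ℝ] ℝ} {β : V → V [⋀^Fin l]→L[ℝ] ℝ} {y : V}
    (hα : DifferentiableAt ℝ α y) (hβ : DifferentiableAt ℝ β y) (v : Fin (k + l + 1) → V) :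
    extDeriv (fun z => wedge (α z) (β z)) y v =
      wedge (extDeriv α y) (β y) (v ∘ Fin.cast (Nat.add_right_comm k 1 l)) +
        (-1) ^ k * wedge (α y) (extDeriv β y) v := by
  have fderiv_eq := ((wedgeL V k l).hasFDerivAt_of_bilinear hα.hasFDerivAt hβ.hasFDerivAt).fderiv
  rw [extDeriv, extDeriv, extDeriv, ← alternatizeUncurryFin_wedge_left,
    ← alternatizeUncurryFin_wedge_right]
  change alternatizeUncurryFin (fderiv ℝ (fun z => wedgeL V k l (α z) (β z)) y) v = _
  rw [fderiv_eq, ContinuousAlternatingMap.alternatizeUncurryFin_add,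
    ContinuousAlternatingMap.add_apply]
  exact add_comm _ _

theorem extDeriv_smul_apply {f : V → ℝ} {β : V → V [⋀^Fin k]→L[ℝ] ℝ} {y : V}
    (hf : DifferentiableAt ℝ f y) (hβ : DifferentiableAt ℝ β y) (v : Fin (k + 1) → V) :
    extDeriv (fun z => f z • β z) y v =
      wedge (extDeriv (fun z => constOfIsEmpty ℝ V (Fin 0) (f z)) y) (β y)
        (v ∘ Fin.cast (Nat.add_comm 1 k)) + f y * extDeriv β y v := by
  have fderiv_eq := (hf.hasFDerivAt.smul hβ.hasFDerivAt).fderiv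
  rw [← alternatizeUncurryFin_smulRight (fderiv ℝ f y)
    (extDeriv (fun z => constOfIsEmpty ℝ V (Fin 0) (f z)) y)
    (fun w => by rw [extDeriv_constOfIsEmpty]; rfl) (β y)]
  change alternatizeUncurryFin (fderiv ℝ (f • β) y) v = _
  rw [fderiv_eq, ContinuousAlternatingMap.alternatizeUncurryFin_add,
    ContinuousAlternatingMap.alternatizeUncurryFin_smul, ContinuousAlternatingMap.add_apply]
  exact add_comm _ _

theorem support_extDeriv_subset (η : V → V [⋀^Fin k]→L[ℝ] ℝ) :
    Function.support (extDeriv η) ⊆ tsupport η := by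
  refine Function.support_subset_iff'.2 fun y hy => ?_
  have extDeriv_eq : extDeriv η y = extDeriv (0 : V → V [⋀^Fin k]→L[ℝ] ℝ) y :=
    (notMem_tsupport_iff_eventuallyEq.1 hy).extDeriv_eq
  rw [extDeriv_eq, extDeriv, fderiv_zero]
  exact map_zero (ContinuousAlternatingMap.alternatizeUncurryFinCLM ℝ V ℝ)

theorem support_extDeriv_apply_subset (η : V → V [⋀^Fin k]→L[ℝ] ℝ) (v : Fin (k + 1) → V) :
    Function.support (fun y => extDeriv η y v) ⊆ tsupport η := fun _ hy =>
  support_extDeriv_subset η fun h => hy (congrArg (· v) h)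

section Integral

variable [MeasurableSpace V] [BorelSpace V] (μ : Measure V)

theorem integrable_extDeriv_apply [IsFiniteMeasureOnCompacts μ] {η : V → V [⋀^Fin k]→L[ℝ] ℝ}
    (hη : ContDiff ℝ 1 η) (hc : HasCompactSupport η) (v : Fin (k + 1) → V) :
    Integrable (fun y => extDeriv η y v) μ := by
  have continuous_apply : Continuous fun y => extDeriv η y v :=
    (ContinuousAlternatingMap.apply ℝ _ ℝ v).continuous.comp
      ((ContinuousAlternatingMap.alternatizeUncurryFinCLM ℝ V ℝ).continuous.comp
        (hη.continuous_fderiv one_ne_zero))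
  exact continuous_apply.integrable_of_hasCompactSupport
    (hc.mono' (support_extDeriv_apply_subset η v))

variable [FiniteDimensional ℝ V] [μ.IsAddHaarMeasure]

theorem integral_fderiv_apply_eq_zero {f : V → ℝ} (hf : ContDiff ℝ 1 f) (hc : HasCompactSupport f)
    (u : V) : ∫ y, fderiv ℝ f y u ∂μ = 0 := by
  have integrable_fderiv : Integrable (fun y => fderiv ℝ f y u) μ :=
    ((hf.continuous_fderiv one_ne_zero).clm_apply
      continuous_const).integrable_of_hasCompactSupport (hc.fderiv_apply ℝ u)
  simpa using integral_mul_fderiv_eq_neg_fderiv_mul_of_integrable (μ := μ) (𝕜 := ℝ)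
    (f := fun _ => (1 : ℝ)) (g := f) (v := u) (by simp) (by simpa using integrable_fderiv)
    (by simpa using hf.continuous.integrable_of_hasCompactSupport hc)
    (by simp) (fun y _ => hf.differentiable one_ne_zero y)

theorem integral_extDeriv_apply_eq_zero {η : V → V [⋀^Fin k]→L[ℝ] ℝ} (hη : ContDiff ℝ 1 η)
    (hc : HasCompactSupport η) (v : Fin (k + 1) → V) : ∫ y, extDeriv η y v ∂μ = 0 := by
  have contDiff_apply (w : Fin k → V) : ContDiff ℝ 1 fun y => η y w :=
    (ContinuousAlternatingMap.apply ℝ _ ℝ w).contDiff.comp hη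
  have compact_apply (w : Fin k → V) : HasCompactSupport fun y => η y w :=
    hc.comp_left (g := fun a : V [⋀^Fin k]→L[ℝ] ℝ => a w) rfl
  have integrable_term (i : Fin (k + 1)) :
      Integrable (fun y => fderiv ℝ (fun y => η y (i.removeNth v)) y (v i)) μ :=
    (((contDiff_apply _).continuous_fderiv one_ne_zero).clm_apply
      continuous_const).integrable_of_hasCompactSupport ((compact_apply _).fderiv_apply ℝ _)
  simp_rw [fun y => extDeriv_apply (hη.differentiable one_ne_zero y) v, zsmul_eq_mul]
  rw [integral_finsetSum _ fun i _ => (integrable_term i).const_mul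
    (((-1 : ℤ) ^ (i : ℕ) : ℤ) : ℝ)]
  refine Finset.sum_eq_zero fun i _ => ?_
  rw [integral_const_mul, integral_fderiv_apply_eq_zero μ (contDiff_apply _) (compact_apply _),
    mul_zero]

theorem setIntegral_extDeriv_apply_eq_zero {η : V → V [⋀^Fin k]→L[ℝ] ℝ} (hη : ContDiff ℝ 1 η)
    (hc : HasCompactSupport η) {U : Set V} (hU : tsupport η ⊆ U) (v : Fin (k + 1) → V) :
    ∫ y in U, extDeriv η y v ∂μ = 0 := by
  rw [setIntegral_eq_integral_of_forall_compl_eq_zero fun y hy =>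
    Function.support_subset_iff'.1 (support_extDeriv_apply_subset η v) y fun h => hy (hU h)]
  exact integral_extDeriv_apply_eq_zero μ hη hc v

end Integral

theorem support_wedge_subset_left {S : Type*} (α : S → V [⋀^Fin k]→L[ℝ] ℝ)
    (β : S → V [⋀^Fin l]→L[ℝ] ℝ) :
    Function.support (fun z => wedge (α z) (β z)) ⊆ Function.support α := by
  refine Function.support_subset_iff'.2 fun y hy => ?_
  rw [Function.notMem_support.1 hy, ← wedgeL_apply, map_zero, zero_apply]

theorem compContinuousLinearMap_smul_eq (α : V [⋀^Fin k]→L[ℝ] ℝ) (c : ℝ) (L : W →L[ℝ] V) :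
    α.compContinuousLinearMap (c • L) = c ^ k • α.compContinuousLinearMap L := by
  ext w
  exact (α.map_smul_univ (fun _ => c) (L ∘ w)).trans (by simp)

end FlatCalculus

/-! ### The operator `d^c` on open subsets of `ℂⁿ` -/

section FlatDc

variable {n k l : ℕ}

/-- The operator `d^c` on forms on open subsets of `ℂⁿ`, given by the formula which defines
`DForm.dc`. -/
def flatDc (α : Cn n → Cn n [⋀^Fin k]→L[ℝ] ℝ) (y : Cn n) : Cn n [⋀^Fin (k + 1)]→L[ℝ] ℝ :=
  (1 / 2 : ℝ) • (extDeriv (fun z => (α z).compContinuousLinearMap ((1 : ℝ) • cplxJ n)) y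
    ).compContinuousLinearMap ((-1 : ℝ) • cplxJ n)

/-- A function on an open subset of `ℂⁿ`, as a `0`-form. -/
def flatFun (f : Cn n → ℝ) (y : Cn n) : Cn n [⋀^Fin 0]→L[ℝ] ℝ :=
  ContinuousAlternatingMap.constOfIsEmpty ℝ (Cn n) (Fin 0) (f y)

theorem contDiffAt_flatFun {f : Cn n → ℝ} {y : Cn n} (hf : ContDiffAt ℝ ∞ f y) :
    ContDiffAt ℝ ∞ (flatFun f) y :=
  contDiffAt_constOfIsEmpty (Cn n) hf

theorem contDiffAt_flatDc {α : Cn n → Cn n [⋀^Fin k]→L[ℝ] ℝ} {y : Cn n}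
    (hα : ContDiffAt ℝ ∞ α y) : ContDiffAt ℝ ∞ (flatDc α) y :=
  (contDiffAt_compContinuousLinearMap_const
    (contDiffAt_extDeriv (contDiffAt_compContinuousLinearMap_const hα _)) _).const_smul _

theorem flatDc_eq_of_invariant {α : Cn n → Cn n [⋀^Fin k]→L[ℝ] ℝ} {y : Cn n}
    (hα : ∀ᶠ z in nhds y, (α z).compContinuousLinearMap (cplxJ n) = α z) :
    flatDc α y = (1 / 2 : ℝ) • (extDeriv α y).compContinuousLinearMap ((-1 : ℝ) • cplxJ n) := by
  have h : (fun z => (α z).compContinuousLinearMap ((1 : ℝ) • cplxJ n)) =ᶠ[nhds y] α := by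
    simp only [one_smul]
    exact hα
  rw [flatDc, h.extDeriv_eq]

theorem flatDc_flatFun (f : Cn n → ℝ) (y : Cn n) :
    flatDc (flatFun f) y =
      (1 / 2 : ℝ) • (extDeriv (flatFun f) y).compContinuousLinearMap ((-1 : ℝ) • cplxJ n) := rfl

theorem tsupport_flatFun_subset (f : Cn n → ℝ) : tsupport (flatFun f) ⊆ tsupport f :=
  closure_mono (Function.support_subset_iff'.2 fun y hy => by
    rw [flatFun, Function.notMem_support.1 hy]
    rfl)

theorem support_flatDc_flatFun_subset (f : Cn n → ℝ) :
    Function.support (flatDc (flatFun f)) ⊆ tsupport f := by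
  refine Function.support_subset_iff'.2 fun y hy => ?_
  rw [flatDc_flatFun, Function.support_subset_iff'.1 (support_extDeriv_subset (flatFun f)) y
    fun h => hy (tsupport_flatFun_subset f h)]
  exact smul_zero _

theorem stdFrame_comp_cast (h : k = l) : stdFrame n l ∘ Fin.cast h = stdFrame n k := rfl

theorem neg_cplxJ_comp_cplxJ (n : ℕ) :
    ((-1 : ℝ) • cplxJ n).comp (cplxJ n) = ContinuousLinearMap.id ℝ (Cn n) := by
  ext1 u
  simp [cplxJ_cplxJ]

/-- `J` preserves top degree forms and turns `dα ∧ d^c β` into a multiple of `d^c α ∧ dβ`. -/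
theorem topCoeff_flatDc_wedge_extDeriv (hkl : k + 1 + (l + 1) = 2 * n)
    {α : Cn n → Cn n [⋀^Fin k]→L[ℝ] ℝ} {β : Cn n → Cn n [⋀^Fin l]→L[ℝ] ℝ} {y : Cn n}
    (hα : ∀ᶠ z in nhds y, (α z).compContinuousLinearMap (cplxJ n) = α z)
    (hβ : ∀ᶠ z in nhds y, (β z).compContinuousLinearMap (cplxJ n) = β z) :
    topCoeff (wedge (flatDc α y) (extDeriv β y)) =
      (-1) ^ (k + 1) * topCoeff (wedge (extDeriv α y) (flatDc β y)) := by
  have pullback_flatDc :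
      (flatDc β y).compContinuousLinearMap (cplxJ n) = (1 / 2 : ℝ) • extDeriv β y := by
    rw [flatDc_eq_of_invariant hβ]
    ext w
    change (1 / 2 : ℝ) * extDeriv β y (((-1 : ℝ) • cplxJ n).comp (cplxJ n) ∘ w) = _
    rw [neg_cplxJ_comp_cplxJ]
    rfl
  have pullback_wedge := topCoeff_compContinuousLinearMap hkl
    (wedge (extDeriv α y) (flatDc β y)) (cplxJ n)
  rw [det_cplxJ, one_mul, ← wedge_compContinuousLinearMap, pullback_flatDc] at pullback_wedge
  rw [← pullback_wedge, flatDc_eq_of_invariant hα, compContinuousLinearMap_smul_eq,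
    wedge_smul_left, wedge_smul_left, wedge_smul_right]
  simp only [topCoeff, ContinuousAlternatingMap.smul_apply, smul_eq_mul]
  ring

section Ddc

variable {f : Cn n → ℝ} {β : Cn n → Cn n [⋀^Fin k]→L[ℝ] ℝ}

theorem topCoeff_ddc_wedge (hk : k + 2 = 2 * n) {y : Cn n} (hf : ContDiffAt ℝ ∞ f y)
    (hβ : ContDiffAt ℝ ∞ β y)
    (hJ : ∀ᶠ z in nhds y, (β z).compContinuousLinearMap (cplxJ n) = β z) :
    topCoeff (wedge (extDeriv (flatDc (flatFun f)) y) (β y)) =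
      topCoeff (extDeriv (fun z => wedge (flatDc (flatFun f) z) (β z)) y) -
        topCoeff (extDeriv (fun z => f z • flatDc β z) y) +
        f y * topCoeff (extDeriv (flatDc β) y) := by
  have leibniz_wedge := extDeriv_wedge_apply (α := flatDc (flatFun f))
    ((contDiffAt_flatDc (contDiffAt_flatFun hf)).differentiableAt (by simp))
    (hβ.differentiableAt (by simp)) (stdFrame n _)
  have leibniz_smul := extDeriv_smul_apply (hf.differentiableAt (by simp))
    ((contDiffAt_flatDc hβ).differentiableAt (by simp)) (stdFrame n _)
  have swap := topCoeff_flatDc_wedge_extDeriv (α := flatFun f) (by omega)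
    (Filter.Eventually.of_forall fun _ => rfl) hJ
  simp only [stdFrame_comp_cast] at leibniz_wedge leibniz_smul
  simp only [topCoeff] at swap ⊢
  rw [leibniz_smul]
  refine Eq.trans ?_ (congrArg (· - _ + _) leibniz_wedge.symm)
  change _ = _ + (-1) ^ 1 * wedge (flatDc (flatFun f) y) (extDeriv β y) (stdFrame n _) -
    (wedge (extDeriv (flatFun f) y) (flatDc β y) (stdFrame n _) + _) + _
  rw [show wedge (flatDc (flatFun f) y) (extDeriv β y) (stdFrame n _) = _ from swap]
  change wedge (extDeriv (flatDc (flatFun f)) y) (β y) (stdFrame n _) = _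
  ring

theorem integral_topCoeff_ddc_wedge (hk : k + 2 = 2 * n) {U : Set (Cn n)} (hU : IsOpen U)
    (hf : ContDiff ℝ ∞ f) (hc : HasCompactSupport f) (hfU : tsupport f ⊆ U)
    (hβ : ∀ y ∈ U, ContDiffAt ℝ ∞ β y)
    (hJ : ∀ z ∈ U, (β z).compContinuousLinearMap (cplxJ n) = β z) :
    ∫ y in U, topCoeff (wedge (extDeriv (flatDc (flatFun f)) y) (β y)) =
      ∫ y in U, f y * topCoeff (extDeriv (flatDc β) y) := by
  let η₁ := fun z => wedge (flatDc (flatFun f) z) (β z)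
  let η₂ := fun z => f z • flatDc β z
  have supp₁ : Function.support η₁ ⊆ tsupport f :=
    (support_wedge_subset_left _ β).trans (support_flatDc_flatFun_subset f)
  have supp₂ : Function.support η₂ ⊆ tsupport f :=
    (Function.support_smul_subset_left f (flatDc β)).trans subset_closure
  have tsupp₁ : tsupport η₁ ⊆ U := (closure_minimal supp₁ (isClosed_tsupport f)).trans hfU
  have tsupp₂ : tsupport η₂ ⊆ U := (closure_minimal supp₂ (isClosed_tsupport f)).trans hfU
  have smooth₁ : ContDiff ℝ 1 η₁ := (contDiff_of_contDiffAt_tsupport fun y hy =>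
    contDiffAt_wedge (contDiffAt_flatDc (contDiffAt_flatFun hf.contDiffAt))
      (hβ y (tsupp₁ hy))).of_le (by simp)
  have smooth₂ : ContDiff ℝ 1 η₂ := (contDiff_of_contDiffAt_tsupport fun y hy =>
    hf.contDiffAt.smul (contDiffAt_flatDc (hβ y (tsupp₂ hy)))).of_le (by simp)
  have int₁ : IntegrableOn (fun y => topCoeff (extDeriv η₁ y)) U :=
    (integrable_extDeriv_apply volume smooth₁ (hc.mono' supp₁) _).integrableOn
  have int₂ : IntegrableOn (fun y => topCoeff (extDeriv η₂ y)) U :=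
    (integrable_extDeriv_apply volume smooth₂ (hc.mono' supp₂) _).integrableOn
  have continuous₃ : Continuous fun y => f y * topCoeff (extDeriv (flatDc β) y) :=
    continuous_of_tsupport fun y hy => hf.continuous.continuousAt.mul <|
      (ContinuousAlternatingMap.apply ℝ _ ℝ _).continuous.continuousAt.comp
        (contDiffAt_extDeriv (contDiffAt_flatDc (hβ y (hfU
          (closure_mono (Function.support_mul_subset_left _ _) hy))))).continuousAt
  have int₃ : IntegrableOn (fun y => f y * topCoeff (extDeriv (flatDc β) y)) U :=
    (continuous₃.integrable_of_hasCompactSupport hc.mul_right).integrableOn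
  have int₁₂ : IntegrableOn (fun y => topCoeff (extDeriv η₁ y) - topCoeff (extDeriv η₂ y)) U :=
    int₁.sub int₂
  rw [setIntegral_congr_fun hU.measurableSet fun y hy => topCoeff_ddc_wedge hk hf.contDiffAt
    (hβ y hy) (Filter.eventually_of_mem (hU.mem_nhds hy) hJ), integral_add int₁₂ int₃,
    integral_sub int₁ int₂]
  have stokes₁ : ∫ y in U, topCoeff (extDeriv η₁ y) = 0 :=
    setIntegral_extDeriv_apply_eq_zero volume smooth₁ (hc.mono' supp₁) tsupp₁ _
  have stokes₂ : ∫ y in U, topCoeff (extDeriv η₂ y) = 0 :=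
    setIntegral_extDeriv_apply_eq_zero volume smooth₂ (hc.mono' supp₂) tsupp₂ _
  rw [stokes₁, stokes₂, sub_zero, zero_add]

end Ddc

end FlatDc

/-! ### Forms in charts -/

section Charts

section Topology

variable {H X : Type*} [TopologicalSpace H] [TopologicalSpace X] {φ ψ : OpenPartialHomeomorph X H}

theorem eventually_mem_target_source {y : H} (hy : y ∈ φ.target) (hyψ : φ.symm y ∈ ψ.source) :
    ∀ᶠ z in nhds y, z ∈ φ.target ∧ φ.symm z ∈ ψ.source :=
  (φ.open_target.eventually_mem hy).and
    ((φ.continuousAt_symm hy).eventually (ψ.open_source.eventually_mem hyψ))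

theorem fderiv_transition_self {E : Type*} [NormedAddCommGroup E] [NormedSpace ℝ E]
    {φ : OpenPartialHomeomorph X E} {y : E} (hy : y ∈ φ.target) :
    fderiv ℝ (fun z => φ (φ.symm z)) y = ContinuousLinearMap.id ℝ E := by
  have right_inv : (fun z => φ (φ.symm z)) =ᶠ[nhds y] id :=
    Filter.eventually_of_mem (φ.open_target.mem_nhds hy) fun z hz => φ.right_inv hz
  rw [right_inv.fderiv_eq, fderiv_id]

end Topology

variable {n : ℕ} {X : Type*} [TopologicalSpace X] [ChartedSpace (Cn n) X] {k l : ℕ}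

section Transition

variable [IsManifold 𝓘(ℂ, Cn n) ω X] {φ ψ χ : OpenPartialHomeomorph X (Cn n)} {y : Cn n}

theorem contDiffAt_complex_transition (hφ : φ ∈ atlas (Cn n) X) (hψ : ψ ∈ atlas (Cn n) X)
    (hy : y ∈ φ.target) (hyψ : φ.symm y ∈ ψ.source) :
    ContDiffAt ℂ ω (fun z => ψ (φ.symm z)) y := by
  have compatible := HasGroupoid.compatible (G := contDiffGroupoid ω 𝓘(ℂ, Cn n)) hφ hψ
  refine (contMDiffOn_iff_contDiffOn.1
    (contMDiffOn_of_mem_contDiffGroupoid compatible)).contDiffAt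
      ((φ.symm.trans ψ).open_source.mem_nhds ?_)
  simp [hy, hyψ]

theorem contDiffAt_transition (hφ : φ ∈ atlas (Cn n) X) (hψ : ψ ∈ atlas (Cn n) X)
    (hy : y ∈ φ.target) (hyψ : φ.symm y ∈ ψ.source) :
    ContDiffAt ℝ ∞ (fun z => ψ (φ.symm z)) y :=
  ((contDiffAt_complex_transition hφ hψ hy hyψ).restrict_scalars ℝ).of_le le_top

theorem fderiv_transition (hφ : φ ∈ atlas (Cn n) X) (hψ : ψ ∈ atlas (Cn n) X)
    (hy : y ∈ φ.target) (hyψ : φ.symm y ∈ ψ.source) :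
    fderiv ℝ (fun z => ψ (φ.symm z)) y =
      (fderiv ℂ (fun z => ψ (φ.symm z)) y).restrictScalars ℝ :=
  DifferentiableAt.fderiv_restrictScalars ℝ
    ((contDiffAt_complex_transition hφ hψ hy hyψ).differentiableAt (by simp))

theorem fderiv_transition_cplxJ (hφ : φ ∈ atlas (Cn n) X) (hψ : ψ ∈ atlas (Cn n) X)
    (hy : y ∈ φ.target) (hyψ : φ.symm y ∈ ψ.source) (u : Cn n) :
    fderiv ℝ (fun z => ψ (φ.symm z)) y (cplxJ n u) =
      cplxJ n (fderiv ℝ (fun z => ψ (φ.symm z)) y u) := by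
  rw [fderiv_transition hφ hψ hy hyψ]
  exact (fderiv ℂ (fun z => ψ (φ.symm z)) y).map_smul Complex.I u

theorem fderiv_transition_comp (hφ : φ ∈ atlas (Cn n) X) (hψ : ψ ∈ atlas (Cn n) X)
    (hχ : χ ∈ atlas (Cn n) X) (hy : y ∈ φ.target) (hyψ : φ.symm y ∈ ψ.source)
    (hyχ : φ.symm y ∈ χ.source) :
    fderiv ℝ (fun z => χ (φ.symm z)) y =
      (fderiv ℝ (fun z => χ (ψ.symm z)) (ψ (φ.symm y))).comp
        (fderiv ℝ (fun z => ψ (φ.symm z)) y) := by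
  have factor : (fun z => χ (φ.symm z)) =ᶠ[nhds y]
      (fun z => χ (ψ.symm z)) ∘ fun z => ψ (φ.symm z) := by
    filter_upwards [eventually_mem_target_source hy hyψ] with z hz
    simp only [Function.comp_apply, ψ.left_inv hz.2]
  rw [factor.fderiv_eq, fderiv_comp]
  · refine (contDiffAt_transition hψ hχ (ψ.map_source hyψ) ?_).differentiableAt (by simp)
    rwa [ψ.left_inv hyψ]
  · exact (contDiffAt_transition hφ hψ hy hyψ).differentiableAt (by simp)

theorem det_fderiv_transition_pos (hφ : φ ∈ atlas (Cn n) X) (hψ : ψ ∈ atlas (Cn n) X)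
    (hy : y ∈ φ.target) (hyψ : φ.symm y ∈ ψ.source) :
    0 < (fderiv ℝ (fun z => ψ (φ.symm z)) y).det := by
  have inverse : (fderiv ℝ (fun z => φ (ψ.symm z)) (ψ (φ.symm y))).comp
      (fderiv ℝ (fun z => ψ (φ.symm z)) y) = ContinuousLinearMap.id ℝ (Cn n) := by
    rw [← fderiv_transition_comp hφ hψ hφ hy hyψ (φ.map_target hy), fderiv_transition_self hy]
  have det_mul_det : (fderiv ℝ (fun z => φ (ψ.symm z)) (ψ (φ.symm y))).det *
      (fderiv ℝ (fun z => ψ (φ.symm z)) y).det = 1 := by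
    simpa [ContinuousLinearMap.det] using
      congrArg (fun L : Cn n →L[ℝ] Cn n => LinearMap.det (L : Cn n →ₗ[ℝ] Cn n)) inverse
  refine lt_of_le_of_ne ?_ (right_ne_zero_of_mul_eq_one det_mul_det).symm
  rw [fderiv_transition hφ hψ hy hyψ]
  exact (Complex.normSq_nonneg _).trans_eq (det_restrictScalars_eq_normSq _).symm

end Transition

theorem DForm.inChart_wedge (α : DForm n X k) (β : DForm n X l)
    (φ : OpenPartialHomeomorph X (Cn n)) (y : Cn n) :
    (α.wedge β).inChart φ y = GauduchonFactor.wedge (α.inChart φ y) (β.inChart φ y) :=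
  (wedge_compContinuousLinearMap _ _ _).symm

theorem DForm.inChart_pow (α : DForm n X 2) (m : ℕ)
    (φ : OpenPartialHomeomorph X (Cn n)) (y : Cn n) :
    (α.pow m).inChart φ y = wedgePow (α.inChart φ y) m :=
  (wedgePow_compContinuousLinearMap _ _ _).symm

theorem inChart_ofFun (f : X → ℝ) (φ : OpenPartialHomeomorph X (Cn n)) :
    (ofFun n f).inChart φ = flatFun (f ∘ φ.symm) := rfl

theorem DForm.IsSmooth.contDiffAt {α : DForm n X k} (hα : α.IsSmooth)
    {φ : OpenPartialHomeomorph X (Cn n)} (hφ : φ ∈ atlas (Cn n) X) {y : Cn n}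
    (hy : y ∈ φ.target) : ContDiffAt ℝ ∞ (α.inChart φ) y :=
  (hα φ hφ).contDiffAt (φ.open_target.mem_nhds hy)

theorem DForm.isSmooth_of_inChart_eq {α : DForm n X k}
    {β : OpenPartialHomeomorph X (Cn n) → Cn n → Cn n [⋀^Fin k]→L[ℝ] ℝ}
    (h : ∀ φ ∈ atlas (Cn n) X, ∀ y ∈ φ.target, α.inChart φ y = β φ y)
    (hβ : ∀ φ ∈ atlas (Cn n) X, ∀ y ∈ φ.target, ContDiffAt ℝ ∞ (β φ) y) : α.IsSmooth :=
  fun φ hφ => ContDiffOn.congr (fun y hy => (hβ φ hφ y hy).contDiffWithinAt) (h φ hφ)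

theorem DForm.IsSmooth.wedge {α : DForm n X k} {β : DForm n X l} (hα : α.IsSmooth)
    (hβ : β.IsSmooth) : (α.wedge β).IsSmooth :=
  DForm.isSmooth_of_inChart_eq (fun φ _ y _ => DForm.inChart_wedge α β φ y)
    fun _ hφ _ hy => contDiffAt_wedge (hα.contDiffAt hφ hy) (hβ.contDiffAt hφ hy)

theorem DForm.IsSmooth.pow {α : DForm n X 2} (hα : α.IsSmooth) (m : ℕ) : (α.pow m).IsSmooth :=
  DForm.isSmooth_of_inChart_eq (fun φ _ y _ => DForm.inChart_pow α m φ y)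
    fun _ hφ _ hy => contDiffAt_wedgePow (hα.contDiffAt hφ hy) m

variable [IsManifold 𝓘(ℂ, Cn n) ω X] {φ ψ : OpenPartialHomeomorph X (Cn n)} {y : Cn n}

theorem DForm.inChart_eq_pullback (α : DForm n X k) (hφ : φ ∈ atlas (Cn n) X)
    (hψ : ψ ∈ atlas (Cn n) X) (hy : y ∈ φ.target) (hyψ : φ.symm y ∈ ψ.source) :
    α.inChart φ y = (α.inChart ψ (ψ (φ.symm y))).compContinuousLinearMap
      (fderiv ℝ (fun z => ψ (φ.symm z)) y) := by
  rw [DForm.inChart, DForm.inChart, ψ.left_inv hyψ,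
    fderiv_transition_comp hφ hψ (chart_mem_atlas (Cn n) (φ.symm y)) hy hyψ (mem_chart_source _ _)]
  rfl

theorem DForm.inChart_compJ (α : DForm n X k) (c : ℝ) (hφ : φ ∈ atlas (Cn n) X)
    (hy : y ∈ φ.target) :
    (α.compJ c).inChart φ y = (α.inChart φ y).compContinuousLinearMap (c • cplxJ n) := by
  ext w
  change α (φ.symm y) (fun i => c • cplxJ n (fderiv ℝ _ y (w i))) =
    α (φ.symm y) (fun i => fderiv ℝ _ y (c • cplxJ n (w i)))
  simp only [map_smul, fderiv_transition_cplxJ hφ (chart_mem_atlas (Cn n) (φ.symm y)) hy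
    (mem_chart_source _ _)]

theorem DForm.inChart_d {α : DForm n X k} (hα : α.IsSmooth) (hφ : φ ∈ atlas (Cn n) X)
    (hy : y ∈ φ.target) : α.d.inChart φ y = extDeriv (α.inChart φ) y := by
  set ψ := chartAt (Cn n) (φ.symm y)
  have hψ : ψ ∈ atlas (Cn n) X := chart_mem_atlas _ _
  have hyψ : φ.symm y ∈ ψ.source := mem_chart_source _ _
  have pullback : α.inChart φ =ᶠ[nhds y] fun z =>
      (α.inChart ψ (ψ (φ.symm z))).compContinuousLinearMap
        (fderiv ℝ (fun z => ψ (φ.symm z)) z) := by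
    filter_upwards [eventually_mem_target_source hy hyψ] with z hz
    exact α.inChart_eq_pullback hφ hψ hz.1 hz.2
  rw [pullback.extDeriv_eq, extDeriv_pullback (r := ∞)]
  · rfl
  · exact (hα.contDiffAt hψ (ψ.map_source hyψ)).differentiableAt (by simp)
  · exact contDiffAt_transition hφ hψ hy hyψ
  · rw [minSmoothness_of_isRCLikeNormedField]
    exact WithTop.coe_le_coe.2 le_top

theorem DForm.IsSmooth.d {α : DForm n X k} (hα : α.IsSmooth) : α.d.IsSmooth :=
  DForm.isSmooth_of_inChart_eq (fun _ hφ _ hy => DForm.inChart_d hα hφ hy)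
    fun _ hφ _ hy => contDiffAt_extDeriv (hα.contDiffAt hφ hy)

theorem DForm.IsSmooth.compJ {α : DForm n X k} (hα : α.IsSmooth) (c : ℝ) : (α.compJ c).IsSmooth :=
  DForm.isSmooth_of_inChart_eq (fun _ hφ _ hy => α.inChart_compJ c hφ hy)
    fun _ hφ _ hy => contDiffAt_compContinuousLinearMap_const (hα.contDiffAt hφ hy) (c • cplxJ n)

theorem DForm.inChart_dc {α : DForm n X k} (hα : α.IsSmooth) (hφ : φ ∈ atlas (Cn n) X)
    (hy : y ∈ φ.target) : α.dc.inChart φ y = flatDc (α.inChart φ) y := by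
  have inChart_compJ : (α.compJ 1).inChart φ =ᶠ[nhds y]
      fun z => (α.inChart φ z).compContinuousLinearMap ((1 : ℝ) • cplxJ n) :=
    Filter.eventually_of_mem (φ.open_target.mem_nhds hy) fun z hz => α.inChart_compJ 1 hφ hz
  change (1 / 2 : ℝ) • ((α.compJ 1).d.compJ (-1)).inChart φ y = _
  rw [DForm.inChart_compJ _ _ hφ hy, DForm.inChart_d (hα.compJ 1) hφ hy, inChart_compJ.extDeriv_eq,
    flatDc]

theorem DForm.IsSmooth.dc {α : DForm n X k} (hα : α.IsSmooth) : α.dc.IsSmooth :=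
  DForm.isSmooth_of_inChart_eq (fun _ hφ _ hy => DForm.inChart_dc hα hφ hy)
    fun _ hφ _ hy => contDiffAt_flatDc (hα.contDiffAt hφ hy)

theorem DForm.inChart_ddc {α : DForm n X k} (hα : α.IsSmooth) (hφ : φ ∈ atlas (Cn n) X)
    (hy : y ∈ φ.target) : α.ddc.inChart φ y = extDeriv (flatDc (α.inChart φ)) y := by
  have inChart_dc : α.dc.inChart φ =ᶠ[nhds y] flatDc (α.inChart φ) :=
    Filter.eventually_of_mem (φ.open_target.mem_nhds hy) fun z hz => DForm.inChart_dc hα hφ hz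
  rw [DForm.ddc, DForm.inChart_d hα.dc hφ hy, inChart_dc.extDeriv_eq]

theorem DForm.IsSmooth.ddc {α : DForm n X k} (hα : α.IsSmooth) : α.ddc.IsSmooth :=
  hα.dc.d

variable (n X) in
theorem isManifold_real : IsManifold 𝓘(ℝ, Cn n) ∞ X := by
  refine isManifold_of_contDiffOn _ _ _ fun e e' he he' y hy => ?_
  have hy' : y ∈ e.target ∧ e.symm y ∈ e'.source := by simpa using hy
  exact (contDiffAt_transition he he' hy'.1 hy'.2).contDiffWithinAt

theorem contDiffOn_comp_symm {f : X → ℝ} (hf : IsSmoothFun n f) (hφ : φ ∈ atlas (Cn n) X) :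
    ContDiffOn ℝ ∞ (f ∘ φ.symm) φ.target := by
  have := isManifold_real n X
  have smooth_symm : ContMDiffOn 𝓘(ℝ, Cn n) 𝓘(ℝ, Cn n) ∞ φ.symm φ.target :=
    contMDiffOn_symm_of_mem_maximalAtlas (IsManifold.subset_maximalAtlas hφ)
  exact contMDiffOn_iff_contDiffOn.1 (ContMDiff.comp_contMDiffOn hf smooth_symm)

theorem isSmooth_ofFun {f : X → ℝ} (hf : IsSmoothFun n f) : (ofFun n f).IsSmooth :=
  DForm.isSmooth_of_inChart_eq (fun _ _ _ _ => rfl) fun φ hφ _ hy =>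
    contDiffAt_flatFun
      ((contDiffOn_comp_symm hf hφ).contDiffAt (φ.open_target.mem_nhds hy))

theorem DForm.coeffAt_div_eq (hk : k = 2 * n) (hl : l = 2 * n) (α : DForm n X k)
    (β : DForm n X l) (hφ : φ ∈ atlas (Cn n) X) (hy : y ∈ φ.target) :
    α.coeffAt (φ.symm y) / β.coeffAt (φ.symm y) =
      topCoeff (α.inChart φ y) / topCoeff (β.inChart φ y) := by
  have det_pos := det_fderiv_transition_pos hφ (chart_mem_atlas (Cn n) (φ.symm y)) hy
    (mem_chart_source _ _)
  rw [DForm.inChart, DForm.inChart, topCoeff_compContinuousLinearMap hk,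
    topCoeff_compContinuousLinearMap hl]
  exact (mul_div_mul_left _ _ det_pos.ne').symm

theorem IsPositive.compContinuousLinearMap {m : ℕ} {η : Cn n [⋀^Fin 2]→L[ℝ] ℝ} (hη : IsPositive η)
    {L : Cn m →L[ℝ] Cn n} (hL : Function.Injective L)
    (hLJ : ∀ u, L (cplxJ m u) = cplxJ n (L u)) : IsPositive (η.compContinuousLinearMap L) where
  invariant u v := by
    simp only [compContinuousLinearMap_pair, hLJ, hη.invariant]
  pos u hu := by
    rw [compContinuousLinearMap_pair, hLJ]
    exact hη.pos _ ((map_ne_zero_iff L hL).2 hu)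

namespace HermitianMetric

variable (g : HermitianMetric n X)

theorem isPositive_inChart (hφ : φ ∈ atlas (Cn n) X) (hy : y ∈ φ.target) :
    IsPositive (g.form.inChart φ y) := by
  have hψ := chart_mem_atlas (Cn n) (φ.symm y)
  have hyψ := mem_chart_source (Cn n) (φ.symm y)
  refine IsPositive.compContinuousLinearMap ⟨g.invariant _, g.pos _⟩ ?_
    (fderiv_transition_cplxJ hφ hψ hy hyψ)
  exact (LinearMap.equivOfDetNeZero _ (det_fderiv_transition_pos hφ hψ hy hyψ).ne').injective

theorem inChart_pow_compContinuousLinearMap_cplxJ (hφ : φ ∈ atlas (Cn n) X) (hy : y ∈ φ.target)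
    (m : ℕ) : ((g.form.pow m).inChart φ y).compContinuousLinearMap (cplxJ n) =
      (g.form.pow m).inChart φ y := by
  rw [DForm.inChart_pow, ← wedgePow_compContinuousLinearMap,
    (g.isPositive_inChart hφ hy).compContinuousLinearMap_cplxJ]

end HermitianMetric

end Charts

/-! ### The volume measure -/

section Volume

variable {n : ℕ} {X : Type*} [TopologicalSpace X] {φ ψ : OpenPartialHomeomorph X (Cn n)}

theorem measurableSet_target_inter_preimage {H : Type*} [TopologicalSpace H] [MeasurableSpace H]
    [BorelSpace H] [MeasurableSpace X] [BorelSpace X] (φ : OpenPartialHomeomorph X H) {A : Set X}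
    (hA : MeasurableSet A) : MeasurableSet (φ.target ∩ φ.symm ⁻¹' A) := by
  have measurable_symm : Measurable (φ.target.domRestrict φ.symm) :=
    (continuousOn_iff_continuous_domRestrict.1 φ.continuousOn_symm).measurable
  have := φ.open_target.measurableSet.subtype_image (measurable_symm hA)
  rwa [Set.domRestrict_eq, Set.preimage_comp, Subtype.image_preimage_coe] at this

theorem aemeasurable_symm_withDensity [MeasurableSpace X] [BorelSpace X]
    (φ : OpenPartialHomeomorph X (Cn n)) (f : Cn n → ENNReal) :
    AEMeasurable φ.symm
      (((MeasureTheory.volume : Measure (Cn n)).restrict φ.target).withDensity f) :=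
  (φ.continuousOn_symm.aemeasurable φ.open_target.measurableSet).mono_ac
    (withDensity_absolutelyContinuous _ _)

namespace HermitianMetric

variable [ChartedSpace (Cn n) X] (g : HermitianMetric n X)

/-- The density of the top form `ω^n` with respect to Lebesgue measure in a chart. -/
def density (φ : OpenPartialHomeomorph X (Cn n)) (y : Cn n) : ℝ :=
  topCoeff ((g.form.pow n).inChart φ y)

theorem continuousOn_density (hφ : φ ∈ atlas (Cn n) X) : ContinuousOn (g.density φ) φ.target :=
  (ContinuousAlternatingMap.apply ℝ _ ℝ (stdFrame n (2 * n))).continuous.comp_continuousOn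
    (g.smooth.pow n φ hφ).continuousOn

theorem aemeasurable_density (hφ : φ ∈ atlas (Cn n) X) :
    AEMeasurable (fun y => ENNReal.ofReal (g.density φ y))
      ((MeasureTheory.volume : Measure (Cn n)).restrict φ.target) :=
  ((g.continuousOn_density hφ).aemeasurable φ.open_target.measurableSet).ennreal_ofReal

section Manifold

variable [IsManifold 𝓘(ℂ, Cn n) ω X]

theorem density_pos (hφ : φ ∈ atlas (Cn n) X) {y : Cn n} (hy : y ∈ φ.target) :
    0 < g.density φ y := by
  rw [density, DForm.inChart_pow]
  exact (g.isPositive_inChart hφ hy).topCoeff_wedgePow_pos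

theorem density_eq (hφ : φ ∈ atlas (Cn n) X) (hψ : ψ ∈ atlas (Cn n) X) {y : Cn n}
    (hy : y ∈ φ.target) (hyψ : φ.symm y ∈ ψ.source) :
    g.density φ y = (fderiv ℝ (fun z => ψ (φ.symm z)) y).det * g.density ψ (ψ (φ.symm y)) := by
  rw [density, DForm.inChart_eq_pullback _ hφ hψ hy hyψ, topCoeff_compContinuousLinearMap rfl]
  rfl

end Manifold

variable [MeasurableSpace X]

/-- The measure `ω^n` on the domain of a chart, extended by zero. -/
def chartMeasure (φ : OpenPartialHomeomorph X (Cn n)) : Measure X :=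
  (((MeasureTheory.volume : Measure (Cn n)).restrict φ.target).withDensity fun y =>
    ENNReal.ofReal (g.density φ y)).map φ.symm

theorem volume_eq_iSup : g.volume = ⨆ φ ∈ atlas (Cn n) X, g.chartMeasure φ := rfl

variable [BorelSpace X]

theorem chartMeasure_apply (φ : OpenPartialHomeomorph X (Cn n)) {A : Set X}
    (hA : MeasurableSet A) :
    g.chartMeasure φ A = ∫⁻ y in φ.target ∩ φ.symm ⁻¹' A, ENNReal.ofReal (g.density φ y) := by
  rw [chartMeasure, Measure.map_apply_of_aemeasurable (aemeasurable_symm_withDensity φ _) hA,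
    withDensity_apply', Measure.restrict_restrict' φ.open_target.measurableSet, Set.inter_comm]

variable [IsManifold 𝓘(ℂ, Cn n) ω X]

theorem chartMeasure_le (hφ : φ ∈ atlas (Cn n) X) (hψ : ψ ∈ atlas (Cn n) X) {A : Set X}
    (hA : MeasurableSet A) (hAφ : A ⊆ φ.source) : g.chartMeasure ψ A ≤ g.chartMeasure φ A := by
  rw [chartMeasure_apply g ψ hA, chartMeasure_apply g φ hA]
  set S := ψ.target ∩ ψ.symm ⁻¹' A
  have hS : MeasurableSet S := measurableSet_target_inter_preimage ψ hA
  have change_of_density : ∫⁻ y in S, ENNReal.ofReal (g.density ψ y) =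
      ∫⁻ y in S, ENNReal.ofReal |(fderiv ℝ (fun z => φ (ψ.symm z)) y).det| *
        ENNReal.ofReal (g.density φ (φ (ψ.symm y))) := by
    refine setLIntegral_congr_fun hS fun y hy => ?_
    rw [g.density_eq hψ hφ hy.1 (hAφ hy.2), ← ENNReal.ofReal_mul (abs_nonneg _),
      abs_of_pos (det_fderiv_transition_pos hψ hφ hy.1 (hAφ hy.2))]
  have injOn_transition : Set.InjOn (fun z => φ (ψ.symm z)) S := fun y hy z hz h =>
    ψ.symm.injOn hy.1 hz.1 (φ.injOn (hAφ hy.2) (hAφ hz.2) h)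
  rw [change_of_density,
    ← lintegral_image_eq_lintegral_abs_det_fderiv_mul MeasureTheory.volume hS
      (fun y hy => ((contDiffAt_transition hψ hφ hy.1 (hAφ hy.2)).differentiableAt
        (by simp)).hasFDerivAt.hasFDerivWithinAt) injOn_transition
      (fun y => ENNReal.ofReal (g.density φ y))]
  refine lintegral_mono_set ?_
  rintro _ ⟨y, hy, rfl⟩
  refine ⟨φ.map_source (hAφ hy.2), ?_⟩
  rw [Set.mem_preimage, φ.left_inv (hAφ hy.2)]
  exact hy.2

/-- Off the domain of `φ` the other charts are bounded by the measure `∞`, which does not see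
`A`. -/
theorem volume_apply (hφ : φ ∈ atlas (Cn n) X) {A : Set X} (hA : MeasurableSet A)
    (hAφ : A ⊆ φ.source) : g.volume A = g.chartMeasure φ A := by
  refine le_antisymm ?_ ?_
  · have volume_le : g.volume ≤ g.chartMeasure φ + (⊤ : Measure X).restrict φ.sourceᶜ := by
      rw [volume_eq_iSup]
      refine iSup₂_le fun ψ hψ => Measure.le_iff.2 fun s hs => ?_
      have measurableSet_source := φ.open_source.measurableSet
      rw [← measure_inter_add_sdiff s measurableSet_source, Measure.add_apply,
        Measure.restrict_apply hs]
      exact add_le_add ((g.chartMeasure_le hφ hψ (hs.inter measurableSet_source)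
        Set.inter_subset_right).trans (measure_mono Set.inter_subset_left))
          (Measure.le_iff'.1 le_top _)
    refine (Measure.le_iff'.1 volume_le A).trans ?_
    rw [Measure.add_apply, Measure.restrict_apply hA, ← Set.sdiff_eq, Set.sdiff_eq_empty.2 hAφ,
      measure_empty, add_zero]
  · rw [volume_eq_iSup]
    exact Measure.le_iff'.1 (le_iSup₂ (f := fun φ (_ : φ ∈ atlas (Cn n) X) => g.chartMeasure φ)
      φ hφ) A

theorem volume_restrict_source (hφ : φ ∈ atlas (Cn n) X) :
    g.volume.restrict φ.source = g.chartMeasure φ := by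
  ext s hs
  have hsφ := hs.inter φ.open_source.measurableSet
  rw [Measure.restrict_apply hs, g.volume_apply hφ hsφ Set.inter_subset_right,
    g.chartMeasure_apply φ hsφ, g.chartMeasure_apply φ hs]
  congr 2
  ext y
  exact ⟨fun h => ⟨h.1, h.2.1⟩, fun h => ⟨h.1, h.2, φ.map_target h.1⟩⟩

theorem setIntegral_source (hφ : φ ∈ atlas (Cn n) X) {f : X → ℝ} (hf : Continuous f) :
    ∫ x in φ.source, f x ∂g.volume = ∫ y in φ.target, g.density φ y * f (φ.symm y) := by
  rw [g.volume_restrict_source hφ, chartMeasure,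
    integral_map (aemeasurable_symm_withDensity φ _) hf.measurable.aestronglyMeasurable,
    integral_withDensity_eq_integral_toReal_smul₀ (g.aemeasurable_density hφ)
      (Filter.Eventually.of_forall fun y => ENNReal.ofReal_lt_top)]
  refine setIntegral_congr_fun φ.open_target.measurableSet fun y hy => ?_
  simp only [smul_eq_mul, ENNReal.toReal_ofReal (g.density_pos hφ hy).le]

instance isLocallyFiniteMeasure_volume : IsLocallyFiniteMeasure g.volume := by
  refine ⟨fun x => ?_⟩
  set φ := chartAt (Cn n) x
  have hφ : φ ∈ atlas (Cn n) X := chart_mem_atlas _ _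
  have hx : x ∈ φ.source := mem_chart_source _ _
  obtain ⟨r, hr, closedBall_subset⟩ := Metric.nhds_basis_closedBall.mem_iff.1
    (φ.open_target.mem_nhds (φ.map_source hx))
  have hO : IsOpen (φ.source ∩ φ ⁻¹' Metric.ball (φ x) r) :=
    φ.isOpen_inter_preimage Metric.isOpen_ball
  have integrableOn_density : IntegrableOn (g.density φ) (Metric.closedBall (φ x) r) :=
    ((g.continuousOn_density hφ).mono closedBall_subset).integrableOn_compact
      (isCompact_closedBall _ _)
  refine ⟨_, hO.mem_nhds ⟨hx, Metric.mem_ball_self hr⟩, ?_⟩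
  rw [g.volume_apply hφ hO.measurableSet Set.inter_subset_left,
    g.chartMeasure_apply φ hO.measurableSet]
  refine (lintegral_mono_set fun y hy => Metric.ball_subset_closedBall ?_).trans_lt
    integrableOn_density.lintegral_lt_top
  rw [← φ.right_inv hy.1]
  exact hy.2.2

instance isOpenPosMeasure_volume : g.volume.IsOpenPosMeasure := by
  refine ⟨fun O hO ⟨x, hx⟩ => pos_iff_ne_zero.1 ?_⟩
  set φ := chartAt (Cn n) x
  have hφ : φ ∈ atlas (Cn n) X := chart_mem_atlas _ _
  have hxφ : x ∈ φ.source := mem_chart_source _ _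
  have hA : IsOpen (O ∩ φ.source) := hO.inter φ.open_source
  set T := φ.target ∩ φ.symm ⁻¹' (O ∩ φ.source)
  have hT : IsOpen T := φ.symm.isOpen_inter_preimage hA
  have hTne : T.Nonempty := ⟨φ x, φ.map_source hxφ, by simp [φ.left_inv hxφ, hx, hxφ]⟩
  refine lt_of_lt_of_le ?_ (measure_mono (Set.inter_subset_left (s := O) (t := φ.source)))
  rw [g.volume_apply hφ hA.measurableSet Set.inter_subset_right,
    g.chartMeasure_apply φ hA.measurableSet, pos_iff_ne_zero]
  intro integral_eq_zero
  rw [lintegral_eq_zero_iff' ((g.aemeasurable_density hφ).mono_measure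
    (Measure.restrict_mono_set _ Set.inter_subset_left)), Filter.EventuallyEq,
    ae_restrict_iff' hT.measurableSet] at integral_eq_zero
  refine (hT.measure_pos MeasureTheory.volume hTne).ne'
    (measure_mono_null (fun y hy => ?_) integral_eq_zero)
  simpa [hy] using g.density_pos hφ hy.1

end HermitianMetric

end Volume

/-! ### The Laplacian and the gradient -/

section FlatFunctions

variable {n : ℕ} {f : Cn n → ℝ} {y : Cn n}

theorem extDeriv_flatFun_apply (f : Cn n → ℝ) (y : Cn n) (v : Fin (0 + 1) → Cn n) :
    extDeriv (flatFun f) y v = fderiv ℝ f y (v 0) :=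
  congrArg (fun α : Cn n [⋀^Fin (0 + 1)]→L[ℝ] ℝ => α v) (extDeriv_constOfIsEmpty f y)

theorem extDeriv_flatFun_add {f' : Cn n → ℝ} (hf : DifferentiableAt ℝ f y)
    (hf' : DifferentiableAt ℝ f' y) :
    extDeriv (flatFun fun z => f z + f' z) y =
      extDeriv (flatFun f) y + extDeriv (flatFun f') y := by
  ext v
  simp only [ContinuousAlternatingMap.add_apply, extDeriv_flatFun_apply, fderiv_fun_add hf hf']
  rfl

theorem flatDc_flatFun_add {f' : Cn n → ℝ} (hf : DifferentiableAt ℝ f y)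
    (hf' : DifferentiableAt ℝ f' y) :
    flatDc (flatFun fun z => f z + f' z) y = flatDc (flatFun f) y + flatDc (flatFun f') y := by
  rw [flatDc_flatFun, flatDc_flatFun, flatDc_flatFun, extDeriv_flatFun_add hf hf', ← smul_add]
  rfl

theorem extDeriv_flatFun_comp {G : ℝ → ℝ} {c : ℝ} (hf : DifferentiableAt ℝ f y)
    (hG : HasDerivAt G c (f y)) :
    extDeriv (flatFun fun z => G (f z)) y = c • extDeriv (flatFun f) y := by
  have fderiv_comp : fderiv ℝ (fun z => G (f z)) y = c • fderiv ℝ f y :=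
    (hG.comp_hasFDerivAt y hf.hasFDerivAt).fderiv
  ext v
  simp only [ContinuousAlternatingMap.smul_apply, extDeriv_flatFun_apply, fderiv_comp]
  rfl

theorem flatDc_flatFun_comp {G : ℝ → ℝ} {c : ℝ} (hf : DifferentiableAt ℝ f y)
    (hG : HasDerivAt G c (f y)) :
    flatDc (flatFun fun z => G (f z)) y = c • flatDc (flatFun f) y := by
  rw [flatDc_flatFun, flatDc_flatFun, extDeriv_flatFun_comp hf hG, smul_comm]
  rfl

theorem extDeriv_flatDc_flatFun_comp {G G' G'' : ℝ → ℝ} (hf : ContDiffAt ℝ ∞ f y)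
    (hG : ∀ t, HasDerivAt G (G' t) t) (hG' : ∀ t, HasDerivAt G' (G'' t) t) :
    extDeriv (flatDc (flatFun fun z => G (f z))) y =
      G' (f y) • extDeriv (flatDc (flatFun f)) y +
        G'' (f y) • wedge (extDeriv (flatFun f) y) (flatDc (flatFun f) y) := by
  have differentiableAt_f : DifferentiableAt ℝ f y := hf.differentiableAt (by simp)
  have dc_comp : flatDc (flatFun fun z => G (f z)) =ᶠ[nhds y]
      fun z => G' (f z) • flatDc (flatFun f) z := by
    filter_upwards [(hf.of_le (m := 1) (by simp)).eventually (by simp)] with z hz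
    exact flatDc_flatFun_comp (hz.differentiableAt (by simp)) (hG _)
  rw [dc_comp.extDeriv_eq]
  ext v
  rw [extDeriv_smul_apply (f := fun z => G' (f z)) ((hG' _).differentiableAt.comp y
    differentiableAt_f) ((contDiffAt_flatDc (contDiffAt_flatFun hf)).differentiableAt (by simp)),
    add_comm]
  change _ + wedge (extDeriv (flatFun fun z => G' (f z)) y) (flatDc (flatFun f) y) v = _
  rw [extDeriv_flatFun_comp differentiableAt_f (hG' (f y)), wedge_smul_left]
  rfl

end FlatFunctions

section Operators

variable {n : ℕ} {X : Type*} [TopologicalSpace X] [ChartedSpace (Cn n) X]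
  [IsManifold 𝓘(ℂ, Cn n) ω X]

theorem DForm.ddc_apply {k : ℕ} {α : DForm n X k} (hα : α.IsSmooth) (x : X) :
    α.ddc x = extDeriv (flatDc (α.inChart (chartAt (Cn n) x))) (chartAt (Cn n) x x) := by
  refine Filter.EventuallyEq.extDeriv_eq ?_
  filter_upwards [(chartAt (Cn n) x).open_target.mem_nhds (mem_chart_target _ _)] with y hy
  exact DForm.inChart_dc hα (chart_mem_atlas _ _) hy

section Functions

variable {f : X → ℝ} {x : X}

theorem contDiffAt_comp_chartAt_symm (hf : IsSmoothFun n f) (x : X) :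
    ContDiffAt ℝ ∞ (f ∘ (chartAt (Cn n) x).symm) (chartAt (Cn n) x x) :=
  (contDiffOn_comp_symm hf (chart_mem_atlas _ _)).contDiffAt
    ((chartAt (Cn n) x).open_target.mem_nhds (mem_chart_target _ _))

theorem differentiableAt_comp_chartAt_symm (hf : IsSmoothFun n f) (x : X) :
    DifferentiableAt ℝ (f ∘ (chartAt (Cn n) x).symm) (chartAt (Cn n) x x) :=
  (contDiffAt_comp_chartAt_symm hf x).differentiableAt (by simp)

theorem d_ofFun_comp {G : ℝ → ℝ} {c : ℝ} (hf : IsSmoothFun n f) (hG : HasDerivAt G c (f x)) :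
    (ofFun n fun x => G (f x)).d x = c • (ofFun n f).d x :=
  extDeriv_flatFun_comp (differentiableAt_comp_chartAt_symm hf x)
    (by simpa using hG)

theorem dc_ofFun_comp {G : ℝ → ℝ} {c : ℝ} (hf : IsSmoothFun n f) (hG : HasDerivAt G c (f x)) :
    (ofFun n fun x => G (f x)).dc x = c • (ofFun n f).dc x :=
  flatDc_flatFun_comp (differentiableAt_comp_chartAt_symm hf x)
    (by simpa using hG)

theorem ddc_ofFun_comp {G G' G'' : ℝ → ℝ} (hf : IsSmoothFun n f)
    (hG : ∀ t, HasDerivAt G (G' t) t) (hG' : ∀ t, HasDerivAt G' (G'' t) t)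
    (hGf : IsSmoothFun n fun x => G (f x)) (x : X) :
    (ofFun n fun x => G (f x)).ddc x = G' (f x) • (ofFun n f).ddc x +
      G'' (f x) • wedge ((ofFun n f).d x) ((ofFun n f).dc x) := by
  rw [DForm.ddc_apply (isSmooth_ofFun hGf), DForm.ddc_apply (isSmooth_ofFun hf)]
  have := extDeriv_flatDc_flatFun_comp (contDiffAt_comp_chartAt_symm hf x) hG hG'
  rwa [Function.comp_apply, (chartAt (Cn n) x).left_inv (mem_chart_source _ _)] at this

theorem ddc_ofFun_add {f' : X → ℝ} (hf : IsSmoothFun n f) (hf' : IsSmoothFun n f') (x : X) :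
    (ofFun n fun x => f x + f' x).ddc x = (ofFun n f).ddc x + (ofFun n f').ddc x := by
  have hadd : IsSmoothFun n fun x => f x + f' x := ContMDiff.add hf hf'
  have differentiableAt_dc {u : X → ℝ} (hu : IsSmoothFun n u) : DifferentiableAt ℝ
      (flatDc (flatFun (u ∘ (chartAt (Cn n) x).symm))) (chartAt (Cn n) x x) :=
    (contDiffAt_flatDc (contDiffAt_flatFun (contDiffAt_comp_chartAt_symm hu x))).differentiableAt
      (by simp)
  have differentiableAt_comp {u : X → ℝ} (hu : IsSmoothFun n u) {y : Cn n}
      (hy : y ∈ (chartAt (Cn n) x).target) : DifferentiableAt ℝ (u ∘ (chartAt (Cn n) x).symm) y :=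
    ((contDiffOn_comp_symm hu (chart_mem_atlas _ x)).contDiffAt
      ((chartAt (Cn n) x).open_target.mem_nhds hy)).differentiableAt (by simp)
  have dc_add : flatDc (flatFun ((fun x => f x + f' x) ∘ (chartAt (Cn n) x).symm))
      =ᶠ[nhds (chartAt (Cn n) x x)] flatDc (flatFun (f ∘ (chartAt (Cn n) x).symm)) +
        flatDc (flatFun (f' ∘ (chartAt (Cn n) x).symm)) := by
    filter_upwards [(chartAt (Cn n) x).open_target.mem_nhds (mem_chart_target _ _)] with y hy
    exact flatDc_flatFun_add (differentiableAt_comp hf hy) (differentiableAt_comp hf' hy)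
  rw [DForm.ddc_apply (isSmooth_ofFun hadd), DForm.ddc_apply (isSmooth_ofFun hf),
    DForm.ddc_apply (isSmooth_ofFun hf')]
  exact dc_add.extDeriv_eq.trans (extDeriv_add (differentiableAt_dc hf) (differentiableAt_dc hf'))

theorem ddc_ofFun_eq_zero (hf : IsSmoothFun n f) (hx : x ∉ tsupport f) :
    (ofFun n f).ddc x = 0 := by
  have notMem_tsupport :
      chartAt (Cn n) x x ∉ tsupport (f ∘ (chartAt (Cn n) x).symm) := by
    have tendsto_symm := (chartAt (Cn n) x).continuousAt_symm (mem_chart_target (Cn n) x)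
    rw [ContinuousAt, (chartAt (Cn n) x).left_inv (mem_chart_source _ _)] at tendsto_symm
    exact notMem_tsupport_iff_eventuallyEq.2
      (tendsto_symm.eventually (notMem_tsupport_iff_eventuallyEq.1 hx))
  rw [DForm.ddc_apply (isSmooth_ofFun hf)]
  refine Function.support_subset_iff'.1 (support_extDeriv_subset _) _ fun h => notMem_tsupport ?_
  exact closure_minimal (support_flatDc_flatFun_subset _) (isClosed_tsupport _) h

end Functions

namespace HermitianMetric

variable (g : HermitianMetric n X) {f : X → ℝ}

theorem laplacian_comp (hf : IsSmoothFun n f) {G G' G'' : ℝ → ℝ}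
    (hG : ∀ t, HasDerivAt G (G' t) t) (hG' : ∀ t, HasDerivAt G' (G'' t) t)
    (hGf : IsSmoothFun n fun x => G (f x)) (x : X) :
    g.laplacian (fun x => G (f x)) x =
      G' (f x) * g.laplacian f x + G'' (f x) * g.gradSq f x := by
  simp only [laplacian, gradSq, DForm.coeffAt, DForm.wedge, ddc_ofFun_comp hf hG hG' hGf]
  have := wedge_add_left (G' (f x) • (ofFun n f).ddc x)
    (G'' (f x) • wedge ((ofFun n f).d x) ((ofFun n f).dc x)) (g.form.pow (n - 1) x)
  rw [this, wedge_smul_left, wedge_smul_left]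
  simp only [topCoeff, ContinuousAlternatingMap.add_apply, ContinuousAlternatingMap.smul_apply,
    smul_eq_mul]
  ring

theorem gradSq_comp (hf : IsSmoothFun n f) {G : ℝ → ℝ} {c : ℝ} {x : X}
    (hG : HasDerivAt G c (f x)) :
    g.gradSq (fun x => G (f x)) x = c ^ 2 * g.gradSq f x := by
  simp only [gradSq, DForm.coeffAt, DForm.wedge, d_ofFun_comp hf hG, dc_ofFun_comp hf hG,
    wedge_smul_left, wedge_smul_right, topCoeff, ContinuousAlternatingMap.smul_apply, smul_eq_mul]
  ring

theorem laplacian_add {f' : X → ℝ} (hf : IsSmoothFun n f) (hf' : IsSmoothFun n f') (x : X) :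
    g.laplacian (fun x => f x + f' x) x = g.laplacian f x + g.laplacian f' x := by
  simp only [laplacian, DForm.coeffAt, DForm.wedge, ddc_ofFun_add hf hf', wedge_add_left, topCoeff,
    ContinuousAlternatingMap.add_apply]
  ring

theorem laplacian_eq_zero (hf : IsSmoothFun n f) {x : X} (hx : x ∉ tsupport f) :
    g.laplacian f x = 0 := by
  simp only [laplacian, DForm.coeffAt, DForm.wedge, ddc_ofFun_eq_zero hf hx]
  rw [← wedgeL_apply, map_zero]
  simp [topCoeff]

end HermitianMetric

end Operators

section Torsion

variable {n : ℕ} {X : Type*} [TopologicalSpace X] [ChartedSpace (Cn n) X]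

namespace HermitianMetric

variable (g : HermitianMetric n X)

/-- The function `dd^c ω^{n-1} / ω^n`, which measures how far `ω` is from being a Gauduchon
metric. -/
def torsion (x : X) : ℝ := (g.form.pow (n - 1)).ddc.coeffAt x / (g.form.pow n).coeffAt x

theorem coeffAt_pow_pos (x : X) : 0 < (g.form.pow n).coeffAt x :=
  IsPositive.topCoeff_wedgePow_pos ⟨g.invariant x, g.pos x⟩

theorem abs_torsion_le {B : ℝ} (hB : g.DdcBound B) (x : X) : |g.torsion x| ≤ B := by
  have coeffAt_pos := g.coeffAt_pow_pos x
  rw [torsion, abs_div, abs_of_pos coeffAt_pos, div_le_iff₀ coeffAt_pos, abs_le]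
  exact ⟨by linarith [(hB x).1], (hB x).2⟩

variable [IsManifold 𝓘(ℂ, Cn n) ω X] {φ : OpenPartialHomeomorph X (Cn n)}

theorem continuous_coeffAt_div {k : ℕ} (hk : k = 2 * n) {α : DForm n X k} (hα : α.IsSmooth) :
    Continuous fun x => α.coeffAt x / (g.form.pow n).coeffAt x := by
  rw [continuous_iff_continuousAt]
  intro x
  set φ := chartAt (Cn n) x
  have hφ : φ ∈ atlas (Cn n) X := chart_mem_atlas _ _
  have hx : x ∈ φ.source := mem_chart_source _ _
  have target_mem := φ.open_target.mem_nhds (φ.map_source hx)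
  have continuousAt_topCoeff : ContinuousAt (fun y => topCoeff (α.inChart φ y)) (φ x) :=
    (ContinuousAlternatingMap.apply ℝ _ ℝ (stdFrame n k)).continuous.continuousAt.comp
      (hα.contDiffAt hφ (φ.map_source hx)).continuousAt
  have eq_in_chart : (fun x => α.coeffAt x / (g.form.pow n).coeffAt x) =ᶠ[nhds x]
      (fun y => topCoeff (α.inChart φ y) / g.density φ y) ∘ φ := by
    filter_upwards [φ.open_source.mem_nhds hx] with z hz
    have := DForm.coeffAt_div_eq hk rfl α (g.form.pow n) hφ (φ.map_source hz)
    rwa [φ.left_inv hz] at this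
  exact (ContinuousAt.comp (continuousAt_topCoeff.div
    ((g.continuousOn_density hφ).continuousAt target_mem)
    (g.density_pos hφ (φ.map_source hx)).ne') (φ.continuousAt hx)).congr eq_in_chart.symm

theorem continuous_laplacian (hn : 1 ≤ n) {f : X → ℝ} (hf : IsSmoothFun n f) :
    Continuous (g.laplacian f) := by
  have := g.continuous_coeffAt_div (k := 0 + 2 + 2 * (n - 1)) (by omega)
    ((isSmooth_ofFun hf).ddc.wedge (g.smooth.pow (n - 1)))
  exact (continuous_const.mul this).congr fun x => (mul_div_assoc _ _ _).symm

theorem continuous_torsion (hn : 1 ≤ n) : Continuous g.torsion :=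
  g.continuous_coeffAt_div (k := 2 * (n - 1) + 2) (by omega) (g.smooth.pow (n - 1)).ddc

theorem density_mul_coeffAt_div {k : ℕ} (hk : k = 2 * n) (α : DForm n X k)
    (hφ : φ ∈ atlas (Cn n) X) {y : Cn n} (hy : y ∈ φ.target) :
    g.density φ y * (α.coeffAt (φ.symm y) / (g.form.pow n).coeffAt (φ.symm y)) =
      topCoeff (α.inChart φ y) := by
  rw [DForm.coeffAt_div_eq hk rfl α _ hφ hy]
  exact mul_div_cancel₀ _ (g.density_pos hφ hy).ne'

theorem density_mul_laplacian (hn : 1 ≤ n) {f : X → ℝ} (hf : IsSmoothFun n f)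
    (hφ : φ ∈ atlas (Cn n) X) {y : Cn n} (hy : y ∈ φ.target) :
    g.density φ y * g.laplacian f (φ.symm y) =
      n * topCoeff (wedge (extDeriv (flatDc (flatFun (f ∘ φ.symm))) y)
        ((g.form.pow (n - 1)).inChart φ y)) := by
  rw [laplacian, mul_div_assoc, mul_left_comm,
    g.density_mul_coeffAt_div (k := 0 + 2 + 2 * (n - 1)) (by omega) _ hφ hy, DForm.inChart_wedge,
    DForm.inChart_ddc (isSmooth_ofFun hf) hφ hy, inChart_ofFun]

theorem density_mul_torsion (hn : 1 ≤ n) (hφ : φ ∈ atlas (Cn n) X) {y : Cn n}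
    (hy : y ∈ φ.target) :
    g.density φ y * g.torsion (φ.symm y) =
      topCoeff (extDeriv (flatDc ((g.form.pow (n - 1)).inChart φ)) y) := by
  rw [torsion, g.density_mul_coeffAt_div (k := 2 * (n - 1) + 2) (by omega) _ hφ hy,
    DForm.inChart_ddc (g.smooth.pow (n - 1)) hφ hy]

end HermitianMetric

end Torsion

/-! ### Integration by parts -/

section IndicatorChart

variable {n : ℕ} {X : Type*} [TopologicalSpace X] {φ : OpenPartialHomeomorph X (Cn n)}
  {f : X → ℝ} {y : Cn n}

theorem extDeriv_flatDc_flatFun_congr {u v : Cn n → ℝ} (h : u =ᶠ[nhds y] v) :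
    extDeriv (flatDc (flatFun u)) y = extDeriv (flatDc (flatFun v)) y := by
  refine Filter.EventuallyEq.extDeriv_eq ?_
  filter_upwards [h.eventuallyEq_nhds] with z hz
  have flatFun_eq : flatFun u =ᶠ[nhds z] flatFun v := by
    filter_upwards [hz] with t ht
    rw [flatFun, flatFun, ht]
  rw [flatDc_flatFun, flatDc_flatFun, flatFun_eq.extDeriv_eq]

theorem indicator_comp_symm_eventuallyEq (f : X → ℝ) (hy : y ∈ φ.target) :
    φ.target.indicator (f ∘ φ.symm) =ᶠ[nhds y] f ∘ φ.symm :=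
  Set.eqOn_indicator.eventuallyEq_of_mem (φ.open_target.mem_nhds hy)

variable [CompactSpace X]

theorem isCompact_image_tsupport (hfφ : tsupport f ⊆ φ.source) : IsCompact (φ '' tsupport f) :=
  (isClosed_tsupport f).isCompact.image_of_continuousOn (φ.continuousOn.mono hfφ)

theorem tsupport_indicator_comp_symm_subset_image (hfφ : tsupport f ⊆ φ.source) :
    tsupport (φ.target.indicator (f ∘ φ.symm)) ⊆ φ '' tsupport f := by
  refine closure_minimal (fun y hy => ?_) (isCompact_image_tsupport hfφ).isClosed
  obtain ⟨hyφ, hfy⟩ := Set.indicator_apply_ne_zero.1 hy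
  exact ⟨φ.symm y, subset_closure hfy, φ.right_inv hyφ⟩

theorem tsupport_indicator_comp_symm_subset_target (hfφ : tsupport f ⊆ φ.source) :
    tsupport (φ.target.indicator (f ∘ φ.symm)) ⊆ φ.target :=
  (tsupport_indicator_comp_symm_subset_image hfφ).trans
    ((Set.image_mono hfφ).trans φ.image_source_eq_target.subset)

theorem hasCompactSupport_indicator_comp_symm (hfφ : tsupport f ⊆ φ.source) :
    HasCompactSupport (φ.target.indicator (f ∘ φ.symm)) :=
  (isCompact_image_tsupport hfφ).of_isClosed_subset (isClosed_tsupport _)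
    (tsupport_indicator_comp_symm_subset_image hfφ)

theorem contDiff_indicator_comp_symm [ChartedSpace (Cn n) X] [IsManifold 𝓘(ℂ, Cn n) ω X]
    (hf : IsSmoothFun n f) (hφ : φ ∈ atlas (Cn n) X) (hfφ : tsupport f ⊆ φ.source) :
    ContDiff ℝ ∞ (φ.target.indicator (f ∘ φ.symm)) :=
  contDiff_of_contDiffAt_tsupport fun y hy => by
    have hyφ := tsupport_indicator_comp_symm_subset_target hfφ hy
    have contDiffAt_comp := (contDiffOn_comp_symm hf hφ).contDiffAt (φ.open_target.mem_nhds hyφ)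
    exact contDiffAt_comp.congr_of_eventuallyEq (indicator_comp_symm_eventuallyEq f hyφ)

end IndicatorChart

theorem integrable_of_continuous {X : Type*} [TopologicalSpace X] [CompactSpace X]
    [MeasurableSpace X] [BorelSpace X] {μ : Measure X} [IsFiniteMeasure μ] {f : X → ℝ}
    (hf : Continuous f) : Integrable f μ :=
  hf.integrable_of_hasCompactSupport (HasCompactSupport.of_compactSpace f)

section IntegrationByParts

variable {n : ℕ} {X : Type*} [TopologicalSpace X] [ChartedSpace (Cn n) X]
  [IsManifold 𝓘(ℂ, Cn n) ω X]

theorem exists_finset_sum_eq_tsupport_subset_source [CompactSpace X] [T2Space X] {f : X → ℝ}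
    (hf : IsSmoothFun n f) : ∃ (s : Finset X) (F : X → X → ℝ), (∀ i, IsSmoothFun n (F i)) ∧
      (∀ i, tsupport (F i) ⊆ (chartAt (Cn n) i).source) ∧ f = fun x => ∑ i ∈ s, F i x := by
  have := isManifold_real n X
  obtain ⟨χ, hχ⟩ := SmoothPartitionOfUnity.exists_isSubordinate_chartAt_source 𝓘(ℝ, Cn n) X
  have finite_support : {i | (Function.support (χ i)).Nonempty}.Finite :=
    χ.locallyFinite.finite_nonempty_of_compact
  refine ⟨finite_support.toFinset, fun i x => χ i x * f x, fun i => (χ i).contMDiff.mul hf,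
    fun i => (closure_mono (Function.support_mul_subset_left _ _)).trans (hχ i), ?_⟩
  funext x
  rw [← Finset.sum_mul, ← finsum_eq_sum_of_support_subset, χ.sum_eq_one (Set.mem_univ x), one_mul]
  intro i hi
  rw [Set.Finite.coe_toFinset]
  exact ⟨x, hi⟩

namespace HermitianMetric

variable (g : HermitianMetric n X)

theorem laplacian_const (c : ℝ) (x : X) : g.laplacian (fun _ => c) x = 0 := by
  have := g.laplacian_comp (f := fun _ => c) contMDiff_const (G := fun _ => c)
    (fun t => hasDerivAt_const t c) (fun t => hasDerivAt_const t 0) contMDiff_const x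
  simpa using this

theorem laplacian_sum {ι : Type*} (s : Finset ι) {F : ι → X → ℝ}
    (hF : ∀ i, IsSmoothFun n (F i)) (x : X) :
    g.laplacian (fun x => ∑ i ∈ s, F i x) x = ∑ i ∈ s, g.laplacian (F i) x := by
  classical
  induction s using Finset.induction_on with
  | empty => simpa only [Finset.sum_empty] using g.laplacian_const 0 x
  | insert i s hi ih =>
    simp only [Finset.sum_insert hi]
    rw [g.laplacian_add (hF i) (contMDiff_finsetSum fun i _ => hF i), ih]

variable [CompactSpace X] [MeasurableSpace X] [BorelSpace X]

theorem integral_laplacian_of_tsupport_subset (hn : 1 ≤ n) {f : X → ℝ} (hf : IsSmoothFun n f)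
    {φ : OpenPartialHomeomorph X (Cn n)} (hφ : φ ∈ atlas (Cn n) X) (hfφ : tsupport f ⊆ φ.source) :
    ∫ x, g.laplacian f x ∂g.volume = n * ∫ x, f x * g.torsion x ∂g.volume := by
  have continuous_mul : Continuous fun x => f x * g.torsion x :=
    (ContMDiff.continuous hf).mul (g.continuous_torsion hn)
  have laplacian_off (x : X) (hx : x ∉ φ.source) : g.laplacian f x = 0 :=
    g.laplacian_eq_zero hf fun h => hx (hfφ h)
  have mul_off (x : X) (hx : x ∉ φ.source) : f x * g.torsion x = 0 := by
    rw [image_eq_zero_of_notMem_tsupport fun h => hx (hfφ h), zero_mul]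
  rw [← setIntegral_eq_integral_of_forall_compl_eq_zero laplacian_off,
    ← setIntegral_eq_integral_of_forall_compl_eq_zero mul_off,
    g.setIntegral_source hφ (g.continuous_laplacian hn hf), g.setIntegral_source hφ continuous_mul]
  calc ∫ y in φ.target, g.density φ y * g.laplacian f (φ.symm y)
      = n * ∫ y in φ.target, topCoeff (wedge
          (extDeriv (flatDc (flatFun (φ.target.indicator (f ∘ φ.symm)))) y)
          ((g.form.pow (n - 1)).inChart φ y)) := by
        rw [← integral_const_mul]
        refine setIntegral_congr_fun φ.open_target.measurableSet fun y hy => ?_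
        rw [g.density_mul_laplacian hn hf hφ hy,
          extDeriv_flatDc_flatFun_congr (indicator_comp_symm_eventuallyEq f hy)]
    _ = n * ∫ y in φ.target, φ.target.indicator (f ∘ φ.symm) y *
          topCoeff (extDeriv (flatDc ((g.form.pow (n - 1)).inChart φ)) y) := by
        rw [integral_topCoeff_ddc_wedge (k := 2 * (n - 1)) (by omega) φ.open_target
          (contDiff_indicator_comp_symm hf hφ hfφ) (hasCompactSupport_indicator_comp_symm hfφ)
          (tsupport_indicator_comp_symm_subset_target hfφ)
          (fun y hy => (g.smooth.pow (n - 1)).contDiffAt hφ hy)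
          (fun y hy => g.inChart_pow_compContinuousLinearMap_cplxJ hφ hy (n - 1))]
    _ = n * ∫ y in φ.target, g.density φ y * (f (φ.symm y) * g.torsion (φ.symm y)) := by
        congr 1
        refine setIntegral_congr_fun φ.open_target.measurableSet fun y hy => ?_
        simp only [Set.indicator_of_mem hy, Function.comp_apply, ← g.density_mul_torsion hn hφ hy]
        ring

variable [T2Space X]

theorem integral_laplacian (hn : 1 ≤ n) {f : X → ℝ} (hf : IsSmoothFun n f) :
    ∫ x, g.laplacian f x ∂g.volume = n * ∫ x, f x * g.torsion x ∂g.volume := by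
  obtain ⟨s, F, hF, hFs, rfl⟩ := exists_finset_sum_eq_tsupport_subset_source hf
  have continuous_mul (i : X) : Continuous fun x => F i x * g.torsion x :=
    (ContMDiff.continuous (hF i)).mul (g.continuous_torsion hn)
  simp only [g.laplacian_sum s hF, Finset.sum_mul]
  rw [integral_finsetSum s fun i _ => integrable_of_continuous (g.continuous_laplacian hn (hF i)),
    integral_finsetSum s fun i _ => integrable_of_continuous (continuous_mul i), Finset.mul_sum]
  exact Finset.sum_congr rfl fun i _ =>
    g.integral_laplacian_of_tsupport_subset hn (hF i) (chart_mem_atlas (Cn n) i) (hFs i)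

theorem integral_torsion (hn : 1 ≤ n) : ∫ x, g.torsion x ∂g.volume = 0 := by
  have integral_eq := g.integral_laplacian hn (f := fun _ => 1) contMDiff_const
  simp only [laplacian_const, integral_zero, one_mul] at integral_eq
  exact (mul_eq_zero.1 integral_eq.symm).resolve_left (by positivity)

end HermitianMetric

end IntegrationByParts

/-! ### Energy identities for the kernel of the adjoint of the Laplacian -/

section Energy

theorem hasDerivAt_exp_mul (p t : ℝ) :
    HasDerivAt (fun t => Real.exp (p * t)) (p * Real.exp (p * t)) t := by
  simpa [mul_comm] using ((hasDerivAt_id t).const_mul p).exp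

theorem exists_contDiff_hasDerivAt_mul_exp (p : ℝ) : ∃ F : ℝ → ℝ, ContDiff ℝ ∞ F ∧
    ∀ t, HasDerivAt F (p * Real.exp ((p - 1) * t)) t := by
  rcases eq_or_ne p 1 with rfl | hp
  · exact ⟨id, contDiff_id, fun t => by simpa using hasDerivAt_id t⟩
  · refine ⟨fun t => p / (p - 1) * Real.exp ((p - 1) * t), by fun_prop, fun t => ?_⟩
    convert! (hasDerivAt_exp_mul (p - 1) t).const_mul (p / (p - 1)) using 1
    rw [← mul_assoc, div_mul_cancel₀ p (sub_ne_zero.2 hp)]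

variable {n : ℕ} {X : Type*} [TopologicalSpace X] [ChartedSpace (Cn n) X] {w : X → ℝ}

theorem IsSmoothFun.contDiff_comp {G : ℝ → ℝ} (hG : ContDiff ℝ ∞ G) (hw : IsSmoothFun n w) :
    IsSmoothFun n fun x => G (w x) :=
  hG.comp_contMDiff hw

theorem IsSmoothFun.exp_mul (hw : IsSmoothFun n w) (p : ℝ) :
    IsSmoothFun n fun x => Real.exp (p * w x) :=
  hw.contDiff_comp (G := fun t => Real.exp (p * t)) (by fun_prop)

theorem IsSmoothFun.log (hw : IsSmoothFun n w) (w_pos : ∀ x, 0 < w x) :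
    IsSmoothFun n fun x => Real.log (w x) := fun x =>
  (Real.contDiffAt_log.2 (w_pos x).ne').comp_contMDiffAt (hw x)

namespace HermitianMetric

variable [IsManifold 𝓘(ℂ, Cn n) ω X] (g : HermitianMetric n X)

theorem gradSq_exp_sub_const (hw : IsSmoothFun n w) (p m : ℝ) (x : X) :
    g.gradSq (fun x => Real.exp (p / 2 * w x) - m) x =
      (p / 2) ^ 2 * (Real.exp (p * w x) * g.gradSq w x) := by
  rw [g.gradSq_comp hw ((hasDerivAt_exp_mul (p / 2) (w x)).sub_const m), mul_pow,
    ← Real.exp_nat_mul, mul_assoc]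
  push_cast
  ring_nf

theorem mul_exp_mul_gradSq (hw : IsSmoothFun n w) {p : ℝ} {F : ℝ → ℝ} (hF : ContDiff ℝ ∞ F)
    (hF' : ∀ t, HasDerivAt F (p * Real.exp ((p - 1) * t)) t) (x : X) :
    p * (Real.exp (p * w x) * g.gradSq w x) =
      g.laplacian (fun x => Real.exp (p * w x)) x -
        Real.exp (w x) * g.laplacian (fun x => F (w x)) x := by
  have exp_mul_eq : Real.exp (p * w x) = Real.exp (w x) * Real.exp ((p - 1) * w x) := by
    rw [← Real.exp_add]
    ring_nf
  rw [g.laplacian_comp hw (G := fun t => Real.exp (p * t)) (hasDerivAt_exp_mul p)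
    (fun t => (hasDerivAt_exp_mul p t).const_mul p) (hw.exp_mul p),
    g.laplacian_comp hw hF' (fun t => (hasDerivAt_exp_mul (p - 1) t).const_mul p)
      (hw.contDiff_comp hF), exp_mul_eq]
  ring

variable [MeasurableSpace X]

theorem integral_gradSq_exp_sub_const (hw : IsSmoothFun n w) (p m : ℝ) :
    ∫ x, g.gradSq (fun x => Real.exp (p / 2 * w x) - m) x ∂g.volume =
      (p / 2) ^ 2 * ∫ x, Real.exp (p * w x) * g.gradSq w x ∂g.volume := by
  simp_rw [g.gradSq_exp_sub_const hw, integral_const_mul]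

variable [T2Space X] [CompactSpace X] [BorelSpace X]

/-- The function `F` with `F' = p e^{(p-1)t}` is the one for which `p e^{pw} |dw|²` is
`Δ e^{pw} - e^w Δ F(w)`, and the adjoint equation removes the last term. The constant `c` comes for
free, as the torsion has mean zero. -/
theorem mul_integral_exp_mul_gradSq (hn : 1 ≤ n) (hw : IsSmoothFun n w)
    (hker : g.InKerLaplacianAdjoint fun x => Real.exp (w x)) (p c : ℝ) :
    p * ∫ x, Real.exp (p * w x) * g.gradSq w x ∂g.volume =
      n * ∫ x, (Real.exp (p * w x) - c) * g.torsion x ∂g.volume := by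
  obtain ⟨F, hF, hF'⟩ := exists_contDiff_hasDerivAt_mul_exp p
  have continuous_w : Continuous w := ContMDiff.continuous hw
  have continuous_torsion := g.continuous_torsion hn
  have continuous_laplacian_comp_F := g.continuous_laplacian hn (hw.contDiff_comp hF)
  have integral_sub_mul_torsion : ∫ x, (Real.exp (p * w x) - c) * g.torsion x ∂g.volume =
      ∫ x, Real.exp (p * w x) * g.torsion x ∂g.volume := by
    simp_rw [sub_mul]
    rw [integral_sub (integrable_of_continuous (by fun_prop))
      (integrable_of_continuous (by fun_prop)), integral_const_mul, g.integral_torsion hn, mul_zero,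
      sub_zero]
  rw [integral_sub_mul_torsion, ← g.integral_laplacian hn (hw.exp_mul p), ← integral_const_mul]
  simp_rw [g.mul_exp_mul_gradSq hw hF hF']
  rw [integral_sub (integrable_of_continuous (g.continuous_laplacian hn (hw.exp_mul p)))
    (integrable_of_continuous (by fun_prop)), hker.2 _ (hw.contDiff_comp hF), sub_zero]

theorem abs_mul_integral_exp_mul_gradSq_le (hn : 1 ≤ n) (hw : IsSmoothFun n w)
    (hker : g.InKerLaplacianAdjoint fun x => Real.exp (w x)) {B : ℝ} (hB : g.DdcBound B)
    (p c : ℝ) :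
    |p * ∫ x, Real.exp (p * w x) * g.gradSq w x ∂g.volume| ≤
      n * B * ∫ x, |Real.exp (p * w x) - c| ∂g.volume := by
  have continuous_w : Continuous w := ContMDiff.continuous hw
  have continuous_torsion := g.continuous_torsion hn
  rw [g.mul_integral_exp_mul_gradSq hn hw hker p c, abs_mul, Nat.abs_cast, mul_assoc,
    ← integral_const_mul]
  gcongr
  refine abs_integral_le_integral_abs.trans (integral_mono
    (integrable_of_continuous (by fun_prop)) (integrable_of_continuous (by fun_prop)) fun x => ?_)
  simp only [abs_mul]
  rw [mul_comm]
  gcongr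
  exact g.abs_torsion_le hB x

end HermitianMetric

end Energy

/-! ### Quadratic growth from a halving inequality -/

section Growth

theorem le_exp_two_mul_mul_of_le_add_mul {a t E : ℝ} (ha : 0 ≤ a) (ht0 : 0 ≤ t) (ht : t ≤ 1 / 2)
    (h : a ≤ E + t * a) : a ≤ Real.exp (2 * t) * E := by
  have one_le_exp_mul : 1 ≤ Real.exp (2 * t) * (1 - t) := calc
    1 ≤ (2 * t + 1) * (1 - t) := by nlinarith
    _ ≤ Real.exp (2 * t) * (1 - t) :=
      mul_le_mul_of_nonneg_right (Real.add_one_le_exp (2 * t)) (by linarith)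
  calc a ≤ Real.exp (2 * t) * (1 - t) * a := le_mul_of_one_le_left ha one_le_exp_mul
    _ = Real.exp (2 * t) * ((1 - t) * a) := mul_assoc _ _ _
    _ ≤ Real.exp (2 * t) * E := by
      gcongr
      linarith

variable {a : ℝ → ℝ} {K L : ℝ}

theorem le_exp_of_le_sq_half_of_abs_mul_le_two_pow (hK : 0 ≤ K) (ha : ∀ p, 0 ≤ a p)
    (hstep : ∀ p, a p ≤ a (p / 2) ^ 2 + K * p ^ 2 * a p)
    (hbase : ∀ p, |p| * L ≤ 1 → a p ≤ Real.exp (L ^ 2 * p ^ 2)) (k : ℕ) {p : ℝ}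
    (hp : K * p ^ 2 ≤ 1 / 2) (hpL : |p| * L ≤ 2 ^ k) :
    a p ≤ Real.exp ((4 * K + L ^ 2 * (1 / 2) ^ k) * p ^ 2) := by
  induction k generalizing p with
  | zero =>
    refine (hbase p (by simpa using hpL)).trans (Real.exp_le_exp.2 ?_)
    rw [pow_zero, mul_one]
    gcongr
    exact le_add_of_nonneg_left (by positivity)
  | succ k ih =>
    have le_at_half := ih (p := p / 2) (by nlinarith [mul_nonneg hK (sq_nonneg p)]) (by
      rw [abs_div, abs_two]
      rw [pow_succ] at hpL
      linarith)
    have le_add := (hstep p).trans (add_le_add_left (pow_le_pow_left₀ (ha _) le_at_half 2) _)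
    refine (le_exp_two_mul_mul_of_le_add_mul (ha p) (by positivity) hp le_add).trans_eq ?_
    rw [← Real.exp_nat_mul, ← Real.exp_add, pow_succ]
    push_cast
    ring_nf

/-- The halving inequality forgets the constant `L` in the behaviour at `0`: iterating it `k` times
replaces `L ^ 2` by `L ^ 2 / 2 ^ k`, at the cost of at most `4 K` in total. -/
theorem le_exp_of_le_sq_half (hK : 0 ≤ K) (ha : ∀ p, 0 ≤ a p)
    (hstep : ∀ p, a p ≤ a (p / 2) ^ 2 + K * p ^ 2 * a p)
    (hbase : ∀ p, |p| * L ≤ 1 → a p ≤ Real.exp (L ^ 2 * p ^ 2)) {p : ℝ} (hp : K * p ^ 2 ≤ 1 / 2) :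
    a p ≤ Real.exp (4 * K * p ^ 2) := by
  have tendsto_bound : Filter.Tendsto
      (fun k : ℕ => Real.exp ((4 * K + L ^ 2 * (1 / 2) ^ k) * p ^ 2)) Filter.atTop
      (nhds (Real.exp ((4 * K + L ^ 2 * 0) * p ^ 2))) :=
    (Real.continuous_exp.tendsto _).comp
      ((((tendsto_pow_atTop_nhds_zero_of_lt_one (by norm_num) (by norm_num)).const_mul
        _).const_add _).mul_const _)
  rw [mul_zero, add_zero] at tendsto_bound
  obtain ⟨k, hk⟩ := pow_unbounded_of_one_lt (|p| * L) one_lt_two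
  refine ge_of_tendsto tendsto_bound (Filter.eventually_atTop.2 ⟨k, fun j hj => ?_⟩)
  exact le_exp_of_le_sq_half_of_abs_mul_le_two_pow hK ha hstep hbase j hp
    (hk.le.trans (pow_le_pow_right₀ one_le_two hj))

end Growth

/-! ### Moser iteration -/

section Moser

/-- The sum of the series which bounds the constants of a Moser iteration: the `j`-th step, with
exponent `χ ^ j`, contributes a factor of logarithm `L + j log χ`, of which the root of order
`χ ^ j` is taken. -/
def moserSum (χ L : ℝ) : ℝ := ∑' j : ℕ, χ⁻¹ ^ j * (L + j * Real.log χ)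

variable {χ : ℝ}

theorem summable_moserSum (hχ : 1 < χ) (L : ℝ) :
    Summable fun j : ℕ => χ⁻¹ ^ j * (L + j * Real.log χ) := by
  have inv_nonneg : 0 ≤ χ⁻¹ := by positivity
  have inv_lt_one : χ⁻¹ < 1 := inv_lt_one_of_one_lt₀ hχ
  have summable_geometric := (summable_geometric_of_lt_one inv_nonneg inv_lt_one).mul_right L
  have summable_mul_geometric := (summable_pow_mul_geometric_of_norm_lt_one 1
    ((Real.norm_of_nonneg inv_nonneg).trans_lt inv_lt_one)).mul_right (Real.log χ)
  refine (summable_geometric.add summable_mul_geometric).congr fun j => ?_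
  ring

theorem log_le_mul_of_rpow_inv_le {a b c : ℝ} (hχ : 0 < χ) (ha : 0 < a) (hb : 0 < b) (hc : 0 < c)
    (h : a ^ χ⁻¹ ≤ c * b) : Real.log a ≤ χ * (Real.log c + Real.log b) := by
  rw [← inv_mul_le_iff₀ hχ, ← Real.log_rpow ha, ← Real.log_mul hc.ne' hb.ne']
  exact Real.log_le_log (Real.rpow_pos_of_pos ha _) h

theorem log_mul_one_add_mul_pow_le {A s : ℝ} (hχ : 1 ≤ χ) (hA : 0 < A) (hs : 0 ≤ s) (k : ℕ) :
    Real.log (A * (1 + s * χ ^ k)) ≤ Real.log (A * (1 + s)) + k * Real.log χ := by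
  have one_le_pow : 1 ≤ χ ^ k := one_le_pow₀ hχ
  rw [← Real.log_pow, ← Real.log_mul (by positivity) (by positivity), mul_assoc]
  gcongr
  linarith

variable {J : ℝ → ℝ} {A D p : ℝ}

theorem log_le_pow_mul_sum (hχ : 1 < χ) (hA : 0 < A) (hD : 0 ≤ D) (hp : 0 < p) (hJ : ∀ q, 0 < J q)
    (hstep : ∀ q, 0 < q → J (χ * q) ^ χ⁻¹ ≤ A * (1 + D * q) * J q) (k : ℕ) :
    Real.log (J (p * χ ^ k)) ≤ χ ^ k * (Real.log (J p) +
      ∑ j ∈ Finset.range k, χ⁻¹ ^ j * (Real.log (A * (1 + D * p)) + j * Real.log χ)) := by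
  have hχ0 : 0 < χ := by linarith
  induction k with
  | zero => simp
  | succ k ih =>
    have log_factor_le := log_mul_one_add_mul_pow_le hχ.le hA (mul_nonneg hD hp.le) k
    have step := hstep (p * χ ^ k) (by positivity)
    rw [← mul_assoc D] at step
    calc Real.log (J (p * χ ^ (k + 1)))
        = Real.log (J (χ * (p * χ ^ k))) := by rw [pow_succ, ← mul_assoc, mul_comm χ]
      _ ≤ χ * (Real.log (A * (1 + D * p * χ ^ k)) + Real.log (J (p * χ ^ k))) :=
        log_le_mul_of_rpow_inv_le hχ0 (hJ _) (hJ _) (by positivity) step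
      _ ≤ χ * ((Real.log (A * (1 + D * p)) + k * Real.log χ) + χ ^ k * (Real.log (J p) +
          ∑ j ∈ Finset.range k, χ⁻¹ ^ j * (Real.log (A * (1 + D * p)) + j * Real.log χ))) := by
        gcongr
      _ = _ := by
        rw [Finset.sum_range_succ, inv_pow]
        field_simp
        ring

theorem log_le_pow_mul_moserSum (hχ : 1 < χ) (hA : 1 ≤ A) (hD : 0 ≤ D) (hp : 0 < p)
    (hJ : ∀ q, 0 < J q) (hstep : ∀ q, 0 < q → J (χ * q) ^ χ⁻¹ ≤ A * (1 + D * q) * J q) (k : ℕ) :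
    Real.log (J (p * χ ^ k)) ≤
      χ ^ k * (Real.log (J p) + moserSum χ (Real.log (A * (1 + D * p)))) := by
  have log_nonneg : 0 ≤ Real.log (A * (1 + D * p)) :=
    Real.log_nonneg (one_le_mul_of_one_le_of_one_le hA (le_add_of_nonneg_right (by positivity)))
  have log_χ_nonneg : 0 ≤ Real.log χ := Real.log_nonneg hχ.le
  refine (log_le_pow_mul_sum hχ (by linarith) hD hp hJ hstep k).trans ?_
  gcongr
  exact (summable_moserSum hχ _).sum_le_tsum _ fun j _ => by positivity

end Moser

/-! ### Exponential moments -/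

section SquareIntegrable

variable {X : Type*} [MeasurableSpace X] {μ : Measure X} {f : X → ℝ}

theorem two_mul_integral_abs_mul_le {g : X → ℝ} (hf : MemLp f 2 μ) (hg : MemLp g 2 μ) (s : ℝ) :
    2 * s * ∫ x, |f x * g x| ∂μ ≤ ∫ x, f x ^ 2 ∂μ + s ^ 2 * ∫ x, g x ^ 2 ∂μ := by
  rw [← integral_const_mul, ← integral_const_mul,
    ← integral_add hf.integrable_sq (hg.integrable_sq.const_mul _)]
  refine integral_mono ((hf.integrable_mul hg).abs.const_mul _)
    (hf.integrable_sq.add (hg.integrable_sq.const_mul _)) fun x => ?_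
  simp only [abs_mul]
  nlinarith [sq_nonneg (|f x| - s * |g x|), sq_abs (f x), sq_abs (g x)]

variable [IsFiniteMeasure μ]

theorem integral_add_const_sq (hf : MemLp f 2 μ) (a : ℝ) :
    ∫ x, (f x + a) ^ 2 ∂μ =
      ∫ x, f x ^ 2 ∂μ + 2 * a * ∫ x, f x ∂μ + a ^ 2 * μ.real Set.univ := by
  have integrable_f := hf.integrable one_le_two
  have add_sq_eq (x : X) : (f x + a) ^ 2 = f x ^ 2 + 2 * a * f x + a ^ 2 := by ring
  simp_rw [add_sq_eq]
  have integrable_add : Integrable (fun x => f x ^ 2 + 2 * a * f x) μ :=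
    hf.integrable_sq.add (integrable_f.const_mul _)
  rw [integral_add integrable_add (integrable_const _),
    integral_add hf.integrable_sq (integrable_f.const_mul _), integral_const_mul, integral_const,
    smul_eq_mul, mul_comm (a ^ 2)]

theorem integral_add_const_mul_average_sq [NeZero μ] (hf : MemLp f 2 μ) (r : ℝ) :
    ∫ x, (f x + r * ⨍ y, f y ∂μ) ^ 2 ∂μ =
      ∫ x, f x ^ 2 ∂μ + (2 * r + r ^ 2) * ((∫ x, f x ∂μ) ^ 2 / μ.real Set.univ) := by
  rw [integral_add_const_sq hf, average_eq, smul_eq_mul]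
  have := measureReal_univ_ne_zero (μ := μ)
  field_simp
  ring

/-- Write `m` for the mean of `f`. By AM-GM, applied to `f² - m² = (f - m) (f + m)`, half of the
left side of the hypothesis absorbs the part of the right side which involves `f - m`. -/
theorem integral_sq_le_of_integral_sub_average_sq_le [NeZero μ] (hf : MemLp f 2 μ) {s : ℝ}
    (h : ∫ x, (f x - ⨍ y, f y ∂μ) ^ 2 ∂μ ≤ s * ∫ x, |f x ^ 2 - (⨍ y, f y ∂μ) ^ 2| ∂μ) :
    ∫ x, f x ^ 2 ∂μ ≤
      (∫ x, f x ∂μ) ^ 2 / μ.real Set.univ + (2 * s) ^ 2 * ∫ x, f x ^ 2 ∂μ := by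
  have integral_sub_sq := integral_add_const_mul_average_sq hf (-1)
  have integral_add_sq := integral_add_const_mul_average_sq hf 1
  simp only [neg_one_mul, ← sub_eq_add_neg] at integral_sub_sq
  simp only [one_mul] at integral_add_sq
  set m := ⨍ y, f y ∂μ
  have amgm := two_mul_integral_abs_mul_le (hf.sub (memLp_const m)) (hf.add (memLp_const m)) s
  simp only [Pi.sub_apply, Pi.add_apply] at amgm
  have sq_sub_sq_eq (x : X) : f x ^ 2 - m ^ 2 = (f x - m) * (f x + m) := by ring
  simp_rw [sq_sub_sq_eq] at h
  have variance_nonneg : 0 ≤ ∫ x, (f x - m) ^ 2 ∂μ := integral_nonneg fun x => sq_nonneg _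
  rw [integral_sub_sq] at h amgm variance_nonneg
  rw [integral_add_sq] at amgm
  nlinarith [mul_nonneg (sq_nonneg s) variance_nonneg]

end SquareIntegrable

section Moment

open ProbabilityTheory (mgf cgf)

variable {X : Type*} [MeasurableSpace X]

/-- The estimates on `u` which the Moser iteration uses. Here `Q p` stands for the integral of
`exp (p * u) |du|²`, so that `(p / 2) ^ 2 * Q p` is the Dirichlet energy of `exp (p / 2 * u)`, to
which the Sobolev inequality (with exponent `2 * χ`) and the Poincaré inequality apply. The moments
of `exp u` are written as values of the moment generating function of `u`. -/
structure HasEnergyEstimates (μ : Measure X) (u : X → ℝ) (Q : ℝ → ℝ) (χ b A C : ℝ) : Prop where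
  energy : ∀ p c, |p * Q p| ≤ b * ∫ x, |Real.exp (p * u x) - c| ∂μ
  sobolev : ∀ p, mgf u μ (χ * p) ^ χ⁻¹ ≤ A * ((p / 2) ^ 2 * Q p + mgf u μ p)
  poincare : ∀ p, ∫ x, (Real.exp (p / 2 * u x) - ⨍ y, Real.exp (p / 2 * u y) ∂μ) ^ 2 ∂μ ≤
    C * ((p / 2) ^ 2 * Q p)

namespace HasEnergyEstimates

variable {μ : Measure X} {u : X → ℝ} {Q : ℝ → ℝ} {χ b A C p : ℝ}

theorem neg (h : HasEnergyEstimates μ u Q χ b A C) :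
    HasEnergyEstimates μ (-u) (fun p => Q (-p)) χ b A C where
  energy p c := by simpa [mul_neg, neg_mul] using h.energy (-p) c
  sobolev p := by
    simpa only [ProbabilityTheory.mgf_neg, mul_neg, neg_div, neg_sq] using h.sobolev (-p)
  poincare p := by
    simpa only [Pi.neg_apply, neg_div, neg_mul, mul_neg, neg_sq] using h.poincare (-p)

theorem mgf_mul_rpow_inv_le (h : HasEnergyEstimates μ u Q χ b A C) (hp : 0 < p) :
    mgf u μ (χ * p) ^ χ⁻¹ ≤ max |A| 1 * (1 + b / 4 * p) * mgf u μ p := by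
  have mgf_nonneg : 0 ≤ mgf u μ p := ProbabilityTheory.mgf_nonneg
  have energy := h.energy p 0
  simp only [sub_zero, abs_of_pos (Real.exp_pos _), abs_mul, abs_of_pos hp] at energy
  have abs_add_le : |(p / 2) ^ 2 * Q p + mgf u μ p| ≤ (1 + b / 4 * p) * mgf u μ p := calc
    _ ≤ p / 4 * (p * |Q p|) + mgf u μ p := by
      refine (abs_add_le _ _).trans_eq ?_
      rw [abs_of_nonneg mgf_nonneg, abs_mul, abs_of_nonneg (sq_nonneg (p / 2))]
      ring
    _ ≤ p / 4 * (b * mgf u μ p) + mgf u μ p := by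
      exact add_le_add_left (mul_le_mul_of_nonneg_left energy (by positivity)) _
    _ = (1 + b / 4 * p) * mgf u μ p := by ring
  calc _ ≤ A * ((p / 2) ^ 2 * Q p + mgf u μ p) := h.sobolev p
    _ ≤ |A| * |(p / 2) ^ 2 * Q p + mgf u μ p| := (le_abs_self _).trans_eq (abs_mul _ _)
    _ ≤ max |A| 1 * ((1 + b / 4 * p) * mgf u μ p) := by
      gcongr
      exact le_max_left _ _
    _ = _ := (mul_assoc _ _ _).symm

end HasEnergyEstimates

theorem mgf_le_of_abs_mul_le_one {μ : Measure X} [IsFiniteMeasure μ] {u : X → ℝ} {L p : ℝ}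
    (hu : Integrable u μ) (hu0 : ∫ x, u x ∂μ = 0) (huL : ∀ x, |u x| ≤ L) (hp : |p| * L ≤ 1) :
    mgf u μ p ≤ Real.exp (L ^ 2 * p ^ 2) * μ.real Set.univ := by
  have exp_le (x : X) : Real.exp (p * u x) ≤ 1 + p * u x + L ^ 2 * p ^ 2 := by
    have abs_mul_le : |p * u x| ≤ |p| * L := by
      rw [abs_mul]
      exact mul_le_mul_of_nonneg_left (huL x) (abs_nonneg p)
    have mul_sq_le : (p * u x) ^ 2 ≤ (|p| * L) ^ 2 := sq_le_sq' (abs_le.1 abs_mul_le).1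
      (abs_le.1 abs_mul_le).2
    rw [mul_pow |p|, sq_abs] at mul_sq_le
    linarith [(abs_le.1 (Real.abs_exp_sub_one_sub_id_le (abs_mul_le.trans hp))).2]
  have integrable_linear : Integrable (fun x => 1 + p * u x) μ :=
    (integrable_const _).add (hu.const_mul p)
  calc mgf u μ p ≤ ∫ x, (1 + p * u x + L ^ 2 * p ^ 2) ∂μ :=
        integral_mono_of_nonneg (Filter.Eventually.of_forall fun x => Real.exp_nonneg _)
          (integrable_linear.add (integrable_const _)) (Filter.Eventually.of_forall exp_le)
    _ = (L ^ 2 * p ^ 2 + 1) * μ.real Set.univ := by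
        rw [integral_add integrable_linear (integrable_const _),
          integral_add (integrable_const _) (hu.const_mul p), integral_const_mul, hu0,
          integral_const, integral_const, smul_eq_mul, smul_eq_mul]
        ring
    _ ≤ Real.exp (L ^ 2 * p ^ 2) * μ.real Set.univ := by
        gcongr
        exact Real.add_one_le_exp _

variable [TopologicalSpace X] [CompactSpace X] [BorelSpace X] {μ : Measure X} [IsFiniteMeasure μ]
  {u : X → ℝ}

theorem mgf_pos_of_continuous [NeZero μ] (hu : Continuous u) (p : ℝ) : 0 < mgf u μ p :=
  ProbabilityTheory.mgf_pos' (NeZero.ne μ) (integrable_of_continuous (by fun_prop))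

/-- A bound on the rate of growth of the cumulant generating function is an essential bound by the
Chernoff inequality, hence a bound by continuity. -/
theorem mul_le_of_cgf_le [μ.IsOpenPosMeasure] (hu : Continuous u) {χ p T : ℝ} (hχ : 1 < χ)
    (hp : 0 < p) (h : ∀ k : ℕ, cgf u μ (p * χ ^ k) ≤ χ ^ k * T) (x : X) : p * u x ≤ T := by
  by_contra! hx
  obtain ⟨t, ht, htx⟩ : ∃ t, T / p < t ∧ t < u x :=
    exists_between (by rwa [div_lt_iff₀ hp, mul_comm])
  rw [div_lt_iff₀ hp] at ht
  have isOpen_superlevel : IsOpen {y | t < u y} := isOpen_lt continuous_const hu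
  have measure_pos : 0 < μ.real {y | t < u y} :=
    ENNReal.toReal_pos (isOpen_superlevel.measure_pos μ ⟨x, htx⟩).ne' (measure_ne_top _ _)
  have pow_le (k : ℕ) : χ ^ k ≤ -Real.log (μ.real {y | t < u y}) / (t * p - T) := by
    have superlevel_subset : {y | t < u y} ⊆ {y | t ≤ u y} :=
      Set.ofPred_subset_ofPred.2 fun _ => le_of_lt
    have chernoff := (measureReal_mono superlevel_subset).trans
      (ProbabilityTheory.measure_ge_le_exp_cgf (μ := μ) (X := u) (t := p * χ ^ k) t (by positivity)
        (integrable_of_continuous (by fun_prop)))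
    rw [← Real.log_le_iff_le_exp measure_pos] at chernoff
    rw [le_div_iff₀ (by linarith)]
    linarith [h k]
  obtain ⟨k, hk⟩ := pow_unbounded_of_one_lt (-Real.log (μ.real {y | t < u y}) / (t * p - T)) hχ
  exact (pow_le k).not_gt hk

/-- The bound for functions of mean zero in terms of the Sobolev exponent `χ`, the energy constant
`b`, the Sobolev constant `A`, the Poincaré constant `C` and the volume `V`. The iteration starts at
the exponent `(1 + 2 * (|C| * b / 2) ^ 2)⁻¹`, which is small enough for the initial moment to be
controlled by the Poincaré inequality. -/
def supBound (χ b A C V : ℝ) : ℝ :=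
  (1 + 2 * (|C| * b / 2) ^ 2) * (Real.log V + 4 * (|C| * b / 2) ^ 2 +
    moserSum χ (Real.log (max |A| 1 * (1 + b / 4 * (1 + 2 * (|C| * b / 2) ^ 2)⁻¹))))

namespace HasEnergyEstimates

variable {Q : ℝ → ℝ} {χ b A C p : ℝ}

theorem mgf_le_sq_half [NeZero μ] (h : HasEnergyEstimates μ u Q χ b A C) (hu : Continuous u)
    (p : ℝ) : mgf u μ p ≤ mgf u μ (p / 2) ^ 2 / μ.real Set.univ +
      (|C| * b / 2) ^ 2 * p ^ 2 * mgf u μ p := by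
  have exp_half_sq (x : X) : Real.exp (p / 2 * u x) ^ 2 = Real.exp (p * u x) := by
    rw [← Real.exp_nat_mul]
    push_cast
    ring_nf
  have memLp_exp : MemLp (fun x => Real.exp (p / 2 * u x)) 2 μ :=
    (by fun_prop : Continuous fun x => Real.exp (p / 2 * u x)).memLp_of_hasCompactSupport
      (HasCompactSupport.of_compactSpace _)
  have key := integral_sq_le_of_integral_sub_average_sq_le memLp_exp (s := |p| * |C| * b / 4) ?_
  · simp only [exp_half_sq] at key
    refine key.trans_eq ?_
    rw [mgf, mgf]
    congr 2
    rw [← sq_abs p]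
    ring
  simp only [exp_half_sq]
  set m := ⨍ y, Real.exp (p / 2 * u y) ∂μ
  calc ∫ x, (Real.exp (p / 2 * u x) - m) ^ 2 ∂μ ≤ C * ((p / 2) ^ 2 * Q p) := h.poincare p
    _ ≤ |C * ((p / 2) ^ 2 * Q p)| := le_abs_self _
    _ = |C| * |p| / 4 * |p * Q p| := by
      rw [show C * ((p / 2) ^ 2 * Q p) = C * p / 4 * (p * Q p) by ring, abs_mul, abs_div, abs_mul,
        abs_of_pos (four_pos : (0 : ℝ) < 4)]
    _ ≤ |C| * |p| / 4 * (b * ∫ x, |Real.exp (p * u x) - m ^ 2| ∂μ) := by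
      gcongr
      exact h.energy p _
    _ = |p| * |C| * b / 4 * ∫ x, |Real.exp (p * u x) - m ^ 2| ∂μ := by ring

theorem mgf_le_of_integral_eq_zero [NeZero μ] (h : HasEnergyEstimates μ u Q χ b A C)
    (hu : Continuous u) (hu0 : ∫ x, u x ∂μ = 0) (hp : (|C| * b / 2) ^ 2 * p ^ 2 ≤ 1 / 2) :
    mgf u μ p ≤ Real.exp (4 * (|C| * b / 2) ^ 2 * p ^ 2) * μ.real Set.univ := by
  obtain ⟨L, hL⟩ := (isCompact_univ (X := X)).exists_bound_of_continuousOn hu.continuousOn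
  have V_pos := measureReal_univ_pos (μ := μ)
  rw [← div_le_iff₀ V_pos]
  refine le_exp_of_le_sq_half (a := fun p => mgf u μ p / μ.real Set.univ) (L := L)
    (sq_nonneg _) (fun p => div_nonneg ProbabilityTheory.mgf_nonneg V_pos.le) (fun p => ?_)
    (fun p hp => ?_) hp
  · refine (div_le_div_of_nonneg_right (h.mgf_le_sq_half hu p) V_pos.le).trans_eq ?_
    field_simp
  · rw [div_le_iff₀ V_pos]
    exact mgf_le_of_abs_mul_le_one (integrable_of_continuous hu) hu0
      (fun x => hL x (Set.mem_univ x)) hp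

theorem cgf_le_of_integral_eq_zero [NeZero μ] (h : HasEnergyEstimates μ u Q χ b A C)
    (hu : Continuous u) (hu0 : ∫ x, u x ∂μ = 0) (hp : (|C| * b / 2) ^ 2 * p ^ 2 ≤ 1 / 2) :
    cgf u μ p ≤ Real.log (μ.real Set.univ) + 4 * (|C| * b / 2) ^ 2 * p ^ 2 := by
  have log_le := Real.log_le_log (mgf_pos_of_continuous hu p)
    (h.mgf_le_of_integral_eq_zero hu hu0 hp)
  rwa [Real.log_mul (Real.exp_pos _).ne' (measureReal_univ_pos (μ := μ)).ne', Real.log_exp,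
    add_comm] at log_le

variable [μ.IsOpenPosMeasure]

theorem le_supBound (h : HasEnergyEstimates μ u Q χ b A C) (hχ : 1 < χ) (hb : 0 ≤ b)
    (hu : Continuous u) (hu0 : ∫ x, u x ∂μ = 0) (x : X) :
    u x ≤ supBound χ b A C (μ.real Set.univ) := by
  have : Nonempty X := ⟨x⟩
  rw [supBound]
  set K := (|C| * b / 2) ^ 2
  have K_nonneg : 0 ≤ K := sq_nonneg _
  set p := (1 + 2 * K)⁻¹
  have p_pos : 0 < p := by positivity
  have p_le_one : p ≤ 1 := inv_le_one_of_one_le₀ (by linarith)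
  have p_mul_eq_one : p * (1 + 2 * K) = 1 := inv_mul_cancel₀ (by positivity)
  have K_mul_sq_le : K * p ^ 2 ≤ 1 / 2 := by nlinarith
  have moser (k : ℕ) : cgf u μ (p * χ ^ k) ≤
      χ ^ k * (cgf u μ p + moserSum χ (Real.log (max |A| 1 * (1 + b / 4 * p)))) :=
    log_le_pow_mul_moserSum hχ (le_max_right _ _) (by positivity) p_pos (mgf_pos_of_continuous hu)
      (fun q hq => h.mgf_mul_rpow_inv_le hq) k
  have cgf_le : cgf u μ p ≤ Real.log (μ.real Set.univ) + 4 * K :=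
    (h.cgf_le_of_integral_eq_zero hu hu0 K_mul_sq_le).trans
      (add_le_add_right (mul_le_of_le_one_right (by positivity) (pow_le_one₀ p_pos.le p_le_one)) _)
  calc u x = (1 + 2 * K) * (p * u x) := by linear_combination -(u x) * p_mul_eq_one
    _ ≤ _ := by
      gcongr
      exact (mul_le_of_cgf_le hu hχ p_pos moser x).trans (add_le_add_left cgf_le _)

theorem abs_le_supBound (h : HasEnergyEstimates μ u Q χ b A C) (hχ : 1 < χ) (hb : 0 ≤ b)
    (hu : Continuous u) (hu0 : ∫ x, u x ∂μ = 0) (x : X) :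
    |u x| ≤ supBound χ b A C (μ.real Set.univ) :=
  abs_le'.2 ⟨h.le_supBound hχ hb hu hu0 x, h.neg.le_supBound hχ hb hu.neg
    (by simp only [Pi.neg_apply, integral_neg, hu0, neg_zero]) x⟩

end HasEnergyEstimates

end Moment

/-! ### The bound for Gauduchon factors -/

section Gauduchon

namespace HermitianMetric

variable {n : ℕ} {X : Type*} [TopologicalSpace X] [ChartedSpace (Cn n) X]
  [MeasurableSpace X] {g : HermitianMetric n X} {w ρ : X → ℝ} {B CS CP : ℝ}

theorem InKerLaplacianAdjoint.exp_log_sub_const (hker : g.InKerLaplacianAdjoint ρ)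
    (hρ : ∀ x, 0 < ρ x) (c : ℝ) :
    g.InKerLaplacianAdjoint fun x => Real.exp (Real.log (ρ x) - c) := by
  have exp_eq (x : X) : Real.exp (Real.log (ρ x) - c) = Real.exp (-c) * ρ x := by
    rw [sub_eq_neg_add, Real.exp_add, Real.exp_log (hρ x)]
  refine ⟨(hker.1.log hρ).contDiff_comp (G := fun t => Real.exp (t - c))
    (by fun_prop), fun f hf => ?_⟩
  simp_rw [exp_eq, mul_assoc]
  rw [integral_const_mul, hker.2 f hf, mul_zero]

variable [IsManifold 𝓘(ℂ, Cn n) ω X]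

open ProbabilityTheory (mgf)

theorem IsSobolevConstant.mgf_rpow_inv_le (hS : g.IsSobolevConstant CS) (hw : IsSmoothFun n w)
    (p : ℝ) :
    mgf w g.volume ((n : ℝ) / (n - 1) * p) ^ ((n : ℝ) / (n - 1))⁻¹ ≤
      CS * ((p / 2) ^ 2 * (∫ x, Real.exp (p * w x) * g.gradSq w x ∂g.volume) +
        mgf w g.volume p) := by
  have gradient := g.integral_gradSq_exp_sub_const hw p 0
  have sobolev := hS _ (hw.exp_mul (p / 2))
  have abs_exp_rpow (x : X) : |Real.exp (p / 2 * w x)| ^ (2 * (n : ℝ) / (n - 1)) =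
      Real.exp ((n : ℝ) / (n - 1) * p * w x) := by
    rw [Real.abs_exp, ← Real.exp_mul]
    ring_nf
  have abs_exp_sq (x : X) : |Real.exp (p / 2 * w x)| ^ 2 = Real.exp (p * w x) := by
    rw [Real.abs_exp, ← Real.exp_nat_mul]
    push_cast
    ring_nf
  simp only [sub_zero] at gradient
  simpa only [abs_exp_rpow, abs_exp_sq, gradient, inv_div] using! sobolev

variable [CompactSpace X] [BorelSpace X]

theorem IsPoincareConstant.integral_exp_sub_average_sq_le (hP : g.IsPoincareConstant CP)
    (hw : IsSmoothFun n w) (p : ℝ) :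
    ∫ x, (Real.exp (p / 2 * w x) - ⨍ y, Real.exp (p / 2 * w y) ∂g.volume) ^ 2 ∂g.volume ≤
      CP * ((p / 2) ^ 2 * ∫ x, Real.exp (p * w x) * g.gradSq w x ∂g.volume) := by
  set m := ⨍ y, Real.exp (p / 2 * w y) ∂g.volume
  have poincare := hP _ (hw.contDiff_comp (G := fun t => Real.exp (p / 2 * t) - m) (by fun_prop))
    (integral_sub_average _ _)
  simpa only [sq_abs, g.integral_gradSq_exp_sub_const hw p m] using poincare

variable [T2Space X]

theorem hasEnergyEstimates (hn : 1 ≤ n) (hB : g.DdcBound B) (hS : g.IsSobolevConstant CS)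
    (hP : g.IsPoincareConstant CP) (hw : IsSmoothFun n w)
    (hker : g.InKerLaplacianAdjoint fun x => Real.exp (w x)) :
    HasEnergyEstimates g.volume w (fun p => ∫ x, Real.exp (p * w x) * g.gradSq w x ∂g.volume)
      (n / (n - 1)) (n * B) CS CP where
  energy := g.abs_mul_integral_exp_mul_gradSq_le hn hw hker hB
  sobolev := hS.mgf_rpow_inv_le hw
  poincare := hP.integral_exp_sub_average_sq_le hw

theorem abs_le_supBound (hn : 2 ≤ n) (hB : g.DdcBound B) (hS : g.IsSobolevConstant CS)
    (hP : g.IsPoincareConstant CP) (hw : IsSmoothFun n w)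
    (hker : g.InKerLaplacianAdjoint fun x => Real.exp (w x)) (hw0 : ∫ x, w x ∂g.volume = 0)
    (x : X) : |w x| ≤ supBound (n / (n - 1)) (n * B) CS CP (g.volume.real Set.univ) := by
  have two_le_n : (2 : ℝ) ≤ n := by exact_mod_cast hn
  have one_lt_div : 1 < (n : ℝ) / (n - 1) := by
    rw [one_lt_div (by linarith)]
    linarith
  have B_nonneg : 0 ≤ B := (abs_nonneg _).trans (g.abs_torsion_le hB x)
  exact (hasEnergyEstimates (by omega) hB hS hP hw hker).abs_le_supBound one_lt_div
    (by positivity) (ContMDiff.continuous hw) hw0 x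

theorem abs_log_sub_average_le_supBound (hn : 2 ≤ n) (hB : g.DdcBound B)
    (hS : g.IsSobolevConstant CS) (hP : g.IsPoincareConstant CP)
    (hker : g.InKerLaplacianAdjoint ρ) (hρ : ∀ x, 0 < ρ x) (x : X) :
    |Real.log (ρ x) - ⨍ y, Real.log (ρ y) ∂g.volume| ≤
      supBound (n / (n - 1)) (n * B) CS CP (g.volume.real Set.univ) :=
  abs_le_supBound hn hB hS hP
    ((hker.1.log hρ).contDiff_comp (G := fun t => t - _) (by fun_prop))
    (hker.exp_log_sub_const hρ _) (integral_sub_average _ _) x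

theorem le_exp_supBound_mul (hn : 2 ≤ n) (hB : g.DdcBound B) (hS : g.IsSobolevConstant CS)
    (hP : g.IsPoincareConstant CP) (hker : g.InKerLaplacianAdjoint ρ) (hρ : ∀ x, 0 < ρ x)
    (x y : X) :
    ρ x ≤ Real.exp (2 * supBound (n / (n - 1)) (n * B) CS CP (g.volume.real Set.univ)) * ρ y := by
  have log_le_x := (abs_le.1 (abs_log_sub_average_le_supBound hn hB hS hP hker hρ x)).2
  have le_log_y := (abs_le.1 (abs_log_sub_average_le_supBound hn hB hS hP hker hρ y)).1
  rw [← Real.log_le_log_iff (hρ x) (mul_pos (Real.exp_pos _) (hρ y)),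
    Real.log_mul (Real.exp_pos _).ne' (hρ y).ne', Real.log_exp]
  linarith

end HermitianMetric

end Gauduchon

end GauduchonFactor

end

theorem mainTheorem3 (n : ℕ) (hn : 2 ≤ n) (B CS CP V : ℝ) :
    ∃ CG : ℝ, ∀ (X : Type*) [TopologicalSpace X] [T2Space X] [CompactSpace X]
      [ChartedSpace (GauduchonFactor.Cn n) X]
      [IsManifold 𝓘(ℂ, GauduchonFactor.Cn n) ω X]
      [MeasurableSpace X] [BorelSpace X]
      (g : GauduchonFactor.HermitianMetric n X),
      g.DdcBound B → g.IsSobolevConstant CS → g.IsPoincareConstant CP →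
      g.volume.real Set.univ = V →
      ∀ ρ : X → ℝ, g.InKerLaplacianAdjoint ρ → IsGLB (Set.range ρ) 1 →
        ∀ x : X, ρ x ≤ CG := by
  set M := GauduchonFactor.supBound (n / (n - 1)) (n * B) CS CP V with hM
  refine ⟨Real.exp (2 * M), fun X _ _ _ _ _ _ _ g hB hS hP hV ρ hker hρ x => ?_⟩
  have ρ_pos (y : X) : 0 < ρ y := one_pos.trans_le (hρ.1 ⟨y, rfl⟩)
  have harnack (y : X) : ρ x ≤ Real.exp (2 * M) * ρ y := by
    rw [hM, ← hV]
    exact GauduchonFactor.HermitianMetric.le_exp_supBound_mul hn hB hS hP hker ρ_pos x y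
  have div_le_one : ρ x / Real.exp (2 * M) ≤ 1 := by
    refine hρ.2 ?_
    rintro _ ⟨y, rfl⟩
    exact (div_le_iff₀' (Real.exp_pos _)).2 (harnack y)
  rwa [div_le_one₀ (Real.exp_pos _)] at div_le_one
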